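/- **Setting.** Let $\mathbb K$ be a field of characteristic zero, $k$ an odd integer, and $t$ a central variable of degree $1-k$. All algebras are $\mathbb Z$-graded, associative, unital and graded commutative. For a degree $d$ linear map $\Delta$ and homogeneous $a_i$, the Koszul brackets are $$\mathcal K(\Delta)_n(a_1,\dots,a_n)=\sum_{I\sqcup J=\{1,\dots,n\}}\pm(-1)^{|J|}\,\Delta\Big(\prod_{i\in I}a_i\Big)\prod_{j\in J}a_j ,$$ and for a degree zero linear map $f$ with $f(\mathbf 1)=\mathbf 1$ the cumulants are $$\kappa(f)_n(a_1,\dots,a_n)=\sum_{\{I_1,\dots,I_r\}}(-1)^{r-1}(r-1)!\,\pm\prod_{j=1}^r f\Big(\prod_{i\in I_j}a_i\Big),$$ the sum running over the partitions of $\{1,\dots,n\}$ into non-empty blocks; $\pm$ are the Koszul signs. A *degree $k$ derived BV algebra* is a graded commutative algebra $A$ with a degree one $\mathbb K[[t]]$-linear operator $\Delta=\sum_{n\ge0}t^n\Delta_n$ on $A[[t]]$ such that $\Delta_n(\mathbf 1)=0$ for all $n$, $\Delta^2=0$, and $\mathcal K(\Delta)_n(a_1,\dots,a_n)\equiv0\pmod{t^{n-1}}$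 for all $n\ge2$ and $a_1,\dots,a_n\in A$. It is *complete* if $A$ has a filtration $A=F^0A\supseteq F^1A\supseteq\cdots$ by graded subspaces with $F^pA\cdot F^qA\subseteq F^{p+q}A$ and $\Delta_n(F^pA)\subseteq F^pA$, such that $A^i\to\varprojlim_p A^i/F^pA^i$ is bijective for every degree $i$. Its Maurer–Cartan set $\mathrm{MC}_{BV}(A)$ consists of the degree zero elements $a=\sum_{i\ge-1}t^ia_i\in\frac1t F^1A[[t]]$ (so $a_i\in F^1A^{i(k-1)}$) with $$\sum_{n\ge1}\frac1{n!}\mathcal K(\Delta)_n(a,\dots,a)=0,$$ where $\Delta$ and $\mathcal K(\Delta)_n$ are extended $\mathbb K((t))$-linearly to $A((t))$ and the series converges for the filtration $F^pA((t)):=(F^pA)((t))$. Let $(A,\Delta)$ be a complete degree $k$ derived BV algebra, $d_A=\Delta_0$, $\Delta_+=\sum_{n\ge1}t^n\Delta_n$. Let $(B,d_B)$ be a DG commutative algebra and $(\sigma,\tau,h)$ a semifull DG algebra contraction of $(A,d_A)$ onto $(B,d_B)$: $\sigma:A\to B$ and $\tau:B\to A$ are degree zero chain maps and $h:A\to A$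 has degree $-1$, with $$\sigma\tau=\mathrm{id}_B,\quad hd_A+d_Ah=\tau\sigma-\mathrm{id}_A,\quad \sigma h=0,\quad h\tau=0,\quad h^2=0,$$ and, for all $a,b\in A$ and $x,y\in B$, $$h(h(a)h(b))=h(h(a)\tau(x))=h(\tau(x)\tau(y))=h(\mathbf 1_A)=0,$$ $$\sigma(h(a)h(b))=\sigma(h(a)\tau(x))=0,\quad \sigma(\tau(x)\tau(y))=xy,\quad \sigma(\mathbf 1_A)=\mathbf 1_B.$$ Assume that $h$ and $\tau\sigma$ are continuous, i.e. map each $F^pA$ into itself. Extend $\sigma,\tau,h,d_B$ $\mathbb K[[t]]$-linearly, put $$\breve\sigma=\sum_{n\ge0}\sigma(\Delta_+h)^n,\quad \breve\tau=\sum_{n\ge0}(h\Delta_+)^n\tau,\quad \breve h=\sum_{n\ge0}(h\Delta_+)^nh,\quad \Delta'=d_B+\sum_{n\ge0}\sigma\Delta_+(h\Delta_+)^n\tau,$$ and let $F^pB=\tau^{-1}(F^pA)$ be the induced filtration, the only one for which $\sigma$ and $\tau$ are continuous. Let $\mathrm{MC}_{BV}(B)$ be the Maurer–Cartan set defined as above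 from $F^\bullet B$ and $\Delta'$. **Theorem.** For every $b\in\mathrm{MC}_{BV}(B)$ the push-forward $$\mathrm{MC}(\breve\tau)(b)=\sum_{n\ge1}\frac1{n!}\kappa(\breve\tau)_n(b,\dots,b)$$ converges in $A((t))$ (with $\breve\tau$ and its cumulants extended $\mathbb K((t))$-linearly), and $b\mapsto\mathrm{MC}(\breve\tau)(b)$ is a bijection $$\mathrm{MC}_{BV}(B)\;\cong\;\mathrm{MC}_{BV}(A)\cap\operatorname{Ker}(\breve h),$$ whose inverse sends $a\in\mathrm{MC}_{BV}(A)\cap\operatorname{Ker}(\breve h)$ to $\breve\sigma(a)\in\mathrm{MC}_{BV}(B)$. -/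

import Mathlib

open scoped PowerSeries

noncomputable section

namespace DerivedBV

/-! ### Graded commutative algebras, Koszul brackets and cumulants -/

/-- Graded commutativity of a `ℤ`-graded algebra: `a b = (-1)^{|a||b|} b a`. -/
def GradedCommutative {K A : Type*} [Field K] [Ring A] [Algebra K A]
    (𝒜 : ℤ → Submodule K A) : Prop :=
  ∀ (i j : ℤ) (a b : A), a ∈ 𝒜 i → b ∈ 𝒜 j → a * b = (i * j).negOnePow • (b * a)

/-- The linear map `f` is homogeneous of degree `d`. -/
def HasDegree {K M N : Type*} [Field K] [AddCommGroup M] [Module K M]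
    [AddCommGroup N] [Module K N] (ℳ : ℤ → Submodule K M) (𝒩 : ℤ → Submodule K N)
    (d : ℤ) (f : M →ₗ[K] N) : Prop :=
  ∀ (i : ℤ) (x : M), x ∈ ℳ i → f x ∈ 𝒩 (i + d)

/-- The ordered product of the `a i` over those `i` which satisfy `p`. -/
def orderedProd {R : Type*} [Ring R] {n : ℕ} (p : Fin n → Prop) [DecidablePred p]
    (a : Fin n → R) : R :=
  (((List.finRange n).filter (fun i => decide (p i))).map a).prod

/-- The `n`-th Koszul bracket of `Δ`, evaluated at homogeneous elements `a i` of degree `deg i`: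
the sum over all unshuffles, that is, over all `I ⊆ {1, …, n}`, of
`± (-1)^{n - |I|} Δ(∏_{i ∈ I} a_i) ∏_{j ∉ I} a_j`. The Koszul sign `±` collects
`(-1)^{|a_i||a_j|}` for all `j < i` with `i ∈ I` and `j ∉ I`. -/
def koszulBracket {R : Type*} [Ring R] (Δ : R → R) {n : ℕ} (deg : Fin n → ℤ)
    (a : Fin n → R) : R :=
  ∑ I : Finset (Fin n),
    (∑ i ∈ I, ∑ j ∈ Iᶜ, if j < i then deg i * deg j else 0).negOnePow •
      ((-1 : R) ^ (n - I.card) *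
        (Δ (orderedProd (fun i => i ∈ I) a) * orderedProd (fun i => i ∉ I) a))

/-- The `n`-th cumulant of `f`, evaluated at homogeneous elements `a i` of degree `deg i`. It is
the `n`-th Taylor coefficient of `L ∘ S(f) ∘ E`:
`∑_k (1/k!) ∑ ± (-1)^{k-1} (k-1)! f(∏_{i ∈ I_1} a_i) ⋯ f(∏_{i ∈ I_k} a_i)`,
where the inner sum runs over the ordered partitions `(I_1, …, I_k)` of `{1, …, n}` into non-empty
blocks, given here as surjections `c` onto `{1, …, k}`. The Koszul sign `±` collects
`(-1)^{|a_i||a_j|}` for all `i < j` with `c j < c i`. -/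
def cumulant (K : Type*) {R S : Type*} [Field K] [Ring R] [Ring S] [Module K S] (f : R → S)
    {n : ℕ} (deg : Fin n → ℤ) (a : Fin n → R) : S :=
  ∑ k ∈ Finset.Icc 1 n, ∑ c : Fin n → Fin k,
    if Function.Surjective c then
      ((k.factorial : K)⁻¹ * ((-1 : K) ^ (k - 1) * ((k - 1).factorial : K))) •
        ((∑ i : Fin n, ∑ j : Fin n,
            if i < j ∧ c j < c i then deg i * deg j else 0).negOnePow •
          ((List.finRange k).map
            (fun l => f (orderedProd (fun i => c i = l) a))).prod)
    else 0

/-! ### Derived BV algebras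

A `K[[t]]`-linear map `A[[t]] → B[[t]]` is written `∑ tⁿ fₙ` with `fₙ : A → B` linear. For `A = B`
these are the power series with coefficients in `Module.End K A`, and the product of power series
is the composition. The variable `t` is central of even degree `1 - k`. -/

/-- `Δ = ∑ tⁿ Δₙ` is a degree `k` derived BV algebra structure on the graded algebra `A`. Since
the coefficient of `tʲ` in `K(Δ)ₙ(a₁, …, aₙ)` is `K(Δⱼ)ₙ(a₁, …, aₙ)`, the last field says that
`K(Δ)ₙ(a₁, …, aₙ) ≡ 0 (mod t^{n-1})` for all `n ≥ 2`. -/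
structure IsDerivedBV {K A : Type*} [Field K] [Ring A] [Algebra K A]
    (𝒜 : ℤ → Submodule K A) (k : ℤ) (Δ : (Module.End K A)⟦X⟧) : Prop where
  degree : ∀ n : ℕ, HasDegree 𝒜 𝒜 (1 + n * (k - 1)) (PowerSeries.coeff n Δ)
  map_one : ∀ n : ℕ, PowerSeries.coeff n Δ (1 : A) = 0
  sq_zero : Δ * Δ = 0
  bracket : ∀ n : ℕ, 2 ≤ n → ∀ (deg : Fin n → ℤ) (a : Fin n → A), (∀ i, a i ∈ 𝒜 (deg i)) →
    ∀ j : ℕ, j < n - 1 → koszulBracket (fun x : A => PowerSeries.coeff j Δ x) deg a = 0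

/-- A complete descending filtration `A = F⁰A ⊇ F¹A ⊇ ⋯` by graded subspaces, compatible with the
product. Completeness is the bijectivity of `Aⁱ → lim_p Aⁱ / FᵖAⁱ` in every degree `i`. -/
structure IsCompleteFiltration {K A : Type*} [Field K] [Ring A] [Algebra K A]
    (𝒜 : ℤ → Submodule K A) [GradedAlgebra 𝒜] (F : ℕ → Submodule K A) : Prop where
  zero : F 0 = ⊤
  anti : Antitone F
  graded : ∀ (p : ℕ) (x : A), x ∈ F p → ∀ i : ℤ, (DirectSum.decompose 𝒜 x i : A) ∈ F p
  mul : ∀ (p q : ℕ) (x y : A), x ∈ F p → y ∈ F q → x * y ∈ F (p + q)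
  separated : ∀ (i : ℤ) (x : A), x ∈ 𝒜 i → (∀ p, x ∈ F p) → x = 0
  complete : ∀ (i : ℤ) (u : ℕ → A), (∀ p, u p ∈ 𝒜 i) → (∀ p, u (p + 1) - u p ∈ F p) →
    ∃ x ∈ 𝒜 i, ∀ p, x - u p ∈ F p

/-- The linear map `f` is continuous, i.e. it respects the filtrations. -/
def RespectsFiltration {K M N : Type*} [Field K] [AddCommGroup M] [Module K M]
    [AddCommGroup N] [Module K N] (F : ℕ → Submodule K M) (G : ℕ → Submodule K N)
    (f : M →ₗ[K] N) : Prop :=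
  ∀ (p : ℕ) (x : M), x ∈ F p → f x ∈ G p

/-- `(F, Δ)` is a complete derived BV algebra of degree `k`. -/
structure IsCompleteDerivedBV {K A : Type*} [Field K] [Ring A] [Algebra K A]
    (𝒜 : ℤ → Submodule K A) [GradedAlgebra 𝒜] (k : ℤ) (F : ℕ → Submodule K A)
    (Δ : (Module.End K A)⟦X⟧) : Prop where
  bv : IsDerivedBV 𝒜 k Δ
  filtration : IsCompleteFiltration 𝒜 F
  compatible : ∀ n : ℕ, RespectsFiltration F F (PowerSeries.coeff n Δ)

/-! ### Laurent series and Maurer-Cartan elements -/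

theorem laurentExt_bddBelow {K M N : Type*} [Field K] [AddCommGroup M] [Module K M]
    [AddCommGroup N] [Module K N] (f : ℕ → (M →ₗ[K] N)) (x : LaurentSeries M) :
    BddBelow (Function.support (fun m : ℤ => ∑ᶠ n : ℕ, f n (x.coeff (m - n)))) := by
  refine ⟨x.order, fun m hm => ?_⟩
  by_contra hlt
  refine hm (finsum_eq_zero_of_forall_eq_zero fun n => ?_)
  rw [HahnSeries.coeff_eq_zero_of_lt_order (by omega), map_zero]

/-- The `K((t))`-linear extension `A((t)) → B((t))` of `∑ tⁿ fₙ`. The sums over `n` are finite,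
because the coefficients of `x` vanish in sufficiently negative degrees. -/
def laurentExt {K M N : Type*} [Field K] [AddCommGroup M] [Module K M]
    [AddCommGroup N] [Module K N] (f : ℕ → (M →ₗ[K] N)) (x : LaurentSeries M) :
    LaurentSeries N :=
  HahnSeries.ofSuppBddBelow (fun m : ℤ => ∑ᶠ n : ℕ, f n (x.coeff (m - n)))
    (laurentExt_bddBelow f x)

theorem laurentExt_coeff {K M N : Type*} [Field K] [AddCommGroup M] [Module K M]
    [AddCommGroup N] [Module K N] (f : ℕ → (M →ₗ[K] N)) (x : LaurentSeries M) (m : ℤ) :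
    (laurentExt f x).coeff m = ∑ᶠ n : ℕ, f n (x.coeff (m - n)) := rfl

/-- The series `∑_{n ≥ 1} s n` converges to `x` in `A((t))`, for the topology that is defined by
the filtration `Fᵖ(A((t))) = (FᵖA)((t))`. -/
def SeriesConvergesTo {K A : Type*} [Field K] [Ring A] [Algebra K A]
    (F : ℕ → Submodule K A) (s : ℕ → LaurentSeries A) (x : LaurentSeries A) : Prop :=
  ∀ p : ℕ, ∃ N₀ : ℕ, ∀ N ≥ N₀, ∀ m : ℤ, (x - ∑ n ∈ Finset.Icc 1 N, s n).coeff m ∈ F p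

/-- The Maurer-Cartan set of `(A, F, Δ)`: the elements `a = ∑_{i ≥ -1} tⁱ aᵢ` of `t⁻¹ F¹A[[t]]` of
total degree zero, i.e. with `aᵢ ∈ A^{i(k-1)}`, such that `∑_{n ≥ 1} (1/n!) K(Δ)ₙ(a, …, a) = 0`. -/
def MC {K A : Type*} [Field K] [Ring A] [Algebra K A]
    (𝒜 : ℤ → Submodule K A) (k : ℤ) (F : ℕ → Submodule K A)
    (Δ : ℕ → Module.End K A) : Set (LaurentSeries A) :=
  {a | (∀ m : ℤ, m < -1 → a.coeff m = 0) ∧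
    (∀ m : ℤ, a.coeff m ∈ 𝒜 (m * (k - 1))) ∧
    (∀ m : ℤ, a.coeff m ∈ F 1) ∧
    SeriesConvergesTo F (fun n => (n.factorial : K)⁻¹ •
      koszulBracket (laurentExt Δ) (fun _ : Fin n => 0) (fun _ => a)) 0}

/-- `a` is the push-forward `∑_{n ≥ 1} (1/n!) κ(f)ₙ(b, …, b)` of the degree zero element `b` along
`f = ∑ tⁿ fₙ`. -/
def IsPushforward {K A B : Type*} [Field K] [Ring A] [Algebra K A] [Ring B] [Algebra K B]
    (F : ℕ → Submodule K A) (f : ℕ → (B →ₗ[K] A)) (b : LaurentSeries B)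
    (a : LaurentSeries A) : Prop :=
  SeriesConvergesTo F (fun n => (n.factorial : K)⁻¹ •
    cumulant K (laurentExt f) (fun _ : Fin n => 0) (fun _ => b)) a

/-! ### Contractions and homological perturbation -/

/-- `d` makes the graded algebra `A` into a DG algebra. -/
structure IsDGAlgebra {K A : Type*} [Field K] [Ring A] [Algebra K A]
    (𝒜 : ℤ → Submodule K A) (d : Module.End K A) : Prop where
  degree : HasDegree 𝒜 𝒜 1 d
  sq_zero : d ∘ₗ d = 0
  leibniz : ∀ (i : ℤ) (a b : A), a ∈ 𝒜 i → d (a * b) = d a * b + i.negOnePow • (a * d b)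

/-- `(σ, τ, h)` is a contraction of `(A, dA)` onto `(B, dB)`. -/
structure IsContraction {K A B : Type*} [Field K] [Ring A] [Algebra K A] [Ring B] [Algebra K B]
    (𝒜 : ℤ → Submodule K A) (ℬ : ℤ → Submodule K B) (dA : Module.End K A) (dB : Module.End K B)
    (σ : A →ₗ[K] B) (τ : B →ₗ[K] A) (h : Module.End K A) : Prop where
  degree_σ : HasDegree 𝒜 ℬ 0 σ
  degree_τ : HasDegree ℬ 𝒜 0 τ
  degree_h : HasDegree 𝒜 𝒜 (-1) h
  chain_σ : σ ∘ₗ dA = dB ∘ₗ σ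
  chain_τ : τ ∘ₗ dB = dA ∘ₗ τ
  σ_τ : σ ∘ₗ τ = LinearMap.id
  homotopy : h ∘ₗ dA + dA ∘ₗ h = τ ∘ₗ σ - LinearMap.id
  σ_h : σ ∘ₗ h = 0
  h_τ : h ∘ₗ τ = 0
  h_h : h ∘ₗ h = 0

/-- `(σ, τ, h)` is a semifull DG algebra contraction of the DG algebra `(A, dA)` onto the DG
algebra `(B, dB)`. -/
structure IsSemifullDGContraction {K A B : Type*} [Field K] [Ring A] [Algebra K A]
    [Ring B] [Algebra K B] (𝒜 : ℤ → Submodule K A) (ℬ : ℤ → Submodule K B)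
    (dA : Module.End K A) (dB : Module.End K B)
    (σ : A →ₗ[K] B) (τ : B →ₗ[K] A) (h : Module.End K A) : Prop where
  dgA : IsDGAlgebra 𝒜 dA
  dgB : IsDGAlgebra ℬ dB
  contraction : IsContraction 𝒜 ℬ dA dB σ τ h
  h_hh : ∀ a b : A, h (h a * h b) = 0
  h_hτ : ∀ (a : A) (x : B), h (h a * τ x) = 0
  h_ττ : ∀ x y : B, h (τ x * τ y) = 0
  h_one : h 1 = 0
  σ_hh : ∀ a b : A, σ (h a * h b) = 0
  σ_hτ : ∀ (a : A) (x : B), σ (h a * τ x) = 0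
  σ_ττ : ∀ x y : B, σ (τ x * τ y) = x * y
  σ_one : σ 1 = 1

/-- The perturbation `Δ₊ = ∑_{n ≥ 1} tⁿ Δₙ` of `Δ₀`. -/
def plusPart {K A : Type*} [Field K] [AddCommGroup A] [Module K A]
    (Δ : (Module.End K A)⟦X⟧) : (Module.End K A)⟦X⟧ :=
  Δ - PowerSeries.C (PowerSeries.coeff 0 Δ)

/-- The series `∑_{n ≥ 0} pⁿ`, for a power series `p` without constant term: as `pⁿ` is divisible
by `tⁿ`, only the terms with `n ≤ m` contribute to the coefficient of `tᵐ`. -/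
def geomSeries {K A : Type*} [Field K] [AddCommGroup A] [Module K A]
    (p : (Module.End K A)⟦X⟧) : (Module.End K A)⟦X⟧ :=
  PowerSeries.mk fun m => ∑ n ∈ Finset.range (m + 1), PowerSeries.coeff m (p ^ n)

/-- `σ̆ = ∑_{n ≥ 0} σ (Δ₊ h)ⁿ`. -/
def perturbedσ {K A B : Type*} [Field K] [AddCommGroup A] [Module K A]
    [AddCommGroup B] [Module K B] (Δ : (Module.End K A)⟦X⟧) (σ : A →ₗ[K] B)
    (h : Module.End K A) : ℕ → (A →ₗ[K] B) := fun m =>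
  σ ∘ₗ PowerSeries.coeff m (geomSeries (plusPart Δ * PowerSeries.C h))

/-- `τ̆ = ∑_{n ≥ 0} (h Δ₊)ⁿ τ`. -/
def perturbedτ {K A B : Type*} [Field K] [AddCommGroup A] [Module K A]
    [AddCommGroup B] [Module K B] (Δ : (Module.End K A)⟦X⟧) (τ : B →ₗ[K] A)
    (h : Module.End K A) : ℕ → (B →ₗ[K] A) := fun m =>
  PowerSeries.coeff m (geomSeries (PowerSeries.C h * plusPart Δ)) ∘ₗ τ

/-- `h̆ = ∑_{n ≥ 0} (h Δ₊)ⁿ h`. -/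
def perturbedh {K A : Type*} [Field K] [AddCommGroup A] [Module K A]
    (Δ : (Module.End K A)⟦X⟧) (h : Module.End K A) : ℕ → Module.End K A := fun m =>
  PowerSeries.coeff m (geomSeries (PowerSeries.C h * plusPart Δ) * PowerSeries.C h)

/-- The transferred operator `Δ' = dB + ∑_{n ≥ 0} σ Δ₊ (h Δ₊)ⁿ τ`. -/
def transferredΔ {K A B : Type*} [Field K] [AddCommGroup A] [Module K A]
    [AddCommGroup B] [Module K B] (Δ : (Module.End K A)⟦X⟧) (dB : Module.End K B)
    (σ : A →ₗ[K] B) (τ : B →ₗ[K] A) (h : Module.End K A) : ℕ → Module.End K B := fun m =>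
  (if m = 0 then dB else 0) +
    σ ∘ₗ PowerSeries.coeff m (plusPart Δ * geomSeries (PowerSeries.C h * plusPart Δ)) ∘ₗ τ

/-- The filtration induced on `B`, the only one for which `σ` and `τ` are continuous:
`FᵖB = τ⁻¹(FᵖA)`. -/
def inducedFiltration {K A B : Type*} [Field K] [AddCommGroup A] [Module K A]
    [AddCommGroup B] [Module K B] (F : ℕ → Submodule K A) (τ : B →ₗ[K] A) :
    ℕ → Submodule K B := fun p => (F p).comap τ

end DerivedBV

end

/-! At a single even element the Koszul signs disappear and both series become exponential
generating functions: the Maurer–Cartan series of Δ at a is Δ(e^a) e^{-a}, and the push-forward of b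
along f is log f(e^b). So a is Maurer–Cartan exactly when Δ(e^a) = 0, and a is the push-forward of b
as soon as f(e^b) = e^a. Since a may have a pole in t, the powers aⁿ have poles of unbounded order
and e^a need not be a Laurent series. Every identity is therefore stated for truncated series modulo
F^{N+1}, for all N (`mcSum_mem_iff`, `cumulantSum_sub_mem`).

The homotopy identity gives Ker h = Im τ + Im h. The semifull axioms then say that Ker h is a
subalgebra on which σ is multiplicative. Hence for a in Ker h the exponential e^a stays in Ker h and
σ(e^a) = e^{σa}. Moreover Ker h̆ = Ker h, and σ̆ = σ there.

The perturbation lemma supplies Δτ̆ = τ̆Δ', σ̆Δ = Δ'σ̆ and h̆Δ + Δh̆ = τ̆σ̆ - 1. For a in Ker h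
these are evaluated at e^a. The second gives Δ'(e^{σa}) = σ̆Δ(e^a), so σ sends Maurer–Cartan
elements to Maurer–Cartan elements (`mc_S`). The third gives τ̆(e^{σa}) - e^a = h̆Δ(e^a). This
vanishes if a is Maurer–Cartan, so a is the push-forward of σa, and σ is injective on MC(A) ∩ Ker h
(`expSum_sub_mem`, `isPushforward_of_ker`).

For surjectivity, write mc(a) for the Maurer–Cartan series. A Newton iteration starting at τb solves
h(mc(a)) = 0 inside Ker h with σa = b (`newton_step`, `exists_lift`). This weaker equation already
forces e^a = τ̆(e^b), whence Δ(e^a) = τ̆Δ'(e^b) = 0 if b is Maurer–Cartan (`mc_of_mc_S`). The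
congruences on the Koszul brackets enter only here: they keep every correction in t⁻¹A[[t]]
(`koszulBracket_const_mem_orderGE`), so that the limit is a Laurent series with at most a simple
pole. -/

noncomputable section

namespace DerivedBV

/-! ### Formal power series over a filtered ring -/

section FilteredRing

variable {K R : Type*} [Field K] [Ring R] [Algebra K R]

/-- A descending filtration `R = J⁰ ⊇ J¹ ⊇ ⋯` of an algebra which is compatible with products. -/
structure IsRingFiltration (J : ℕ → Submodule K R) : Prop where
  zero : J 0 = ⊤
  anti : Antitone J
  mul : ∀ (p q : ℕ) (x y : R), x ∈ J p → y ∈ J q → x * y ∈ J (p + q)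

variable {J : ℕ → Submodule K R}

theorem IsRingFiltration.mul_left (hJ : IsRingFiltration J) {p : ℕ} (x : R) {y : R}
    (hy : y ∈ J p) : x * y ∈ J p := by
  simpa using hJ.mul 0 p x y (by simp [hJ.zero]) hy

theorem IsRingFiltration.mul_right (hJ : IsRingFiltration J) {p : ℕ} {x : R} (y : R)
    (hx : x ∈ J p) : x * y ∈ J p := by
  simpa using hJ.mul p 0 x y hx (by simp [hJ.zero])

theorem IsRingFiltration.mul_le (hJ : IsRingFiltration J) {p q r : ℕ} (hr : r ≤ p + q) {x y : R}
    (hx : x ∈ J p) (hy : y ∈ J q) : x * y ∈ J r :=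
  hJ.anti hr (hJ.mul p q x y hx hy)

theorem IsRingFiltration.pow (hJ : IsRingFiltration J) {a : R} (ha : a ∈ J 1) (n : ℕ) :
    a ^ n ∈ J n := by
  induction n with
  | zero => simp [hJ.zero]
  | succ n ih => rw [pow_succ]; exact hJ.mul n 1 _ _ ih ha

theorem IsRingFiltration.mul_sub_mul (hJ : IsRingFiltration J) {p : ℕ} {x x' y y' : R}
    (hx : x - x' ∈ J p) (hy : y - y' ∈ J p) : x * y - x' * y' ∈ J p := by
  have : x * y - x' * y' = (x - x') * y + x' * (y - y') := by noncomm_ring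
  rw [this]
  exact (J p).add_mem (hJ.mul_right _ hx) (hJ.mul_left _ hy)

theorem IsRingFiltration.pow_sub_pow (hJ : IsRingFiltration J) {p : ℕ} {x y : R}
    (h : x - y ∈ J p) (n : ℕ) : x ^ n - y ^ n ∈ J p := by
  induction n with
  | zero => simp
  | succ n ih => rw [pow_succ, pow_succ]; exact hJ.mul_sub_mul ih h

theorem IsRingFiltration.add_pow_sub_pow (hJ : IsRingFiltration J) {p : ℕ} {a x : R}
    (ha : a ∈ J 1) (hp : 1 ≤ p) (hx : x ∈ J p) (n : ℕ) : (a + x) ^ n - a ^ n ∈ J (p + n - 1) := by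
  induction n with
  | zero => simp
  | succ n ih =>
    have : (a + x) ^ (n + 1) - a ^ (n + 1) = (a + x) ^ n * x + ((a + x) ^ n - a ^ n) * a := by
      rw [pow_succ, pow_succ]; noncomm_ring
    rw [this]
    exact (J _).add_mem
      (hJ.mul_le (by omega) (hJ.pow ((J 1).add_mem ha (hJ.anti hp hx)) n) hx)
      (hJ.mul_le (by omega) ih ha)

/-- The sum of the coefficients of degree at most `N` of a power series. -/
def partialSum (N : ℕ) (q : R⟦X⟧) : R :=
  ∑ n ∈ Finset.range (N + 1), PowerSeries.coeff n q

/-- The product of the partial sums differs from the partial sum of the product by terms q_i r_j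
with i + j > N, all of which lie in J^{N+1}. This is what transports identities of formal power
series to truncated series. -/
theorem partialSum_mul_sub_mem (hJ : IsRingFiltration J) {q r : R⟦X⟧}
    (hq : ∀ n, PowerSeries.coeff n q ∈ J n) (hr : ∀ n, PowerSeries.coeff n r ∈ J n) (N : ℕ) :
    partialSum N (q * r) - partialSum N q * partialSum N r ∈ J (N + 1) := by
  have h1 : partialSum N (q * r) = ∑ i ∈ Finset.range (N + 1), ∑ j ∈ Finset.range (N + 1 - i),
      PowerSeries.coeff i q * PowerSeries.coeff j r := by
    rw [partialSum, ← Finset.sum_range_diag_flip]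
    refine Finset.sum_congr rfl fun n _ => ?_
    rw [PowerSeries.coeff_mul, Finset.Nat.sum_antidiagonal_eq_sum_range_succ_mk]
  rw [h1, partialSum, partialSum, Finset.sum_mul_sum, ← Finset.sum_sub_distrib]
  refine Submodule.sum_mem _ fun i _ => ?_
  rw [← neg_mem_iff, neg_sub, ← Finset.sum_Ico_eq_sub _ (Nat.sub_le _ _)]
  refine Submodule.sum_mem _ fun j hj => hJ.mul_le ?_ (hq i) (hr j)
  have := (Finset.mem_Ico.1 hj).1
  omega

theorem coeff_mul_mem_filtration (hJ : IsRingFiltration J) {q r : R⟦X⟧}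
    (hq : ∀ n, PowerSeries.coeff n q ∈ J n) (hr : ∀ n, PowerSeries.coeff n r ∈ J n) (n : ℕ) :
    PowerSeries.coeff n (q * r) ∈ J n := by
  rw [PowerSeries.coeff_mul]
  refine Submodule.sum_mem _ fun x hx => hJ.mul_le ?_ (hq _) (hr _)
  simp only [Finset.HasAntidiagonal.mem_antidiagonal] at hx
  omega

theorem coeff_one_mem_filtration (hJ : IsRingFiltration J) (n : ℕ) :
    PowerSeries.coeff n (1 : R⟦X⟧) ∈ J n := by
  rw [PowerSeries.coeff_one]
  split_ifs with h
  · simp [h, hJ.zero]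
  · exact zero_mem _

theorem coeff_pow_mem_filtration (hJ : IsRingFiltration J) {q : R⟦X⟧}
    (hq : ∀ n, PowerSeries.coeff n q ∈ J n) (k n : ℕ) : PowerSeries.coeff n (q ^ k) ∈ J n := by
  induction k generalizing n with
  | zero => rw [pow_zero]; exact coeff_one_mem_filtration hJ n
  | succ k ih => rw [pow_succ]; exact coeff_mul_mem_filtration hJ ih hq n

theorem partialSum_one (N : ℕ) : partialSum N (1 : R⟦X⟧) = 1 := by
  simp [partialSum, PowerSeries.coeff_one]

theorem partialSum_pow_sub_mem (hJ : IsRingFiltration J) {q : R⟦X⟧}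
    (hq : ∀ n, PowerSeries.coeff n q ∈ J n) (N k : ℕ) :
    partialSum N (q ^ k) - partialSum N q ^ k ∈ J (N + 1) := by
  induction k with
  | zero => simp [partialSum_one]
  | succ k ih =>
    rw [pow_succ, pow_succ]
    have h1 := partialSum_mul_sub_mem hJ (coeff_pow_mem_filtration hJ hq k) hq N
    have h2 := hJ.mul_sub_mul (y := partialSum N q) (y' := partialSum N q) ih (by simp)
    simpa using (J _).add_mem h1 h2

/-- The image of `f(X)` under `X ↦ a X`. -/
def substMul (a : R) (f : K⟦X⟧) : R⟦X⟧ :=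
  PowerSeries.mk fun n => PowerSeries.coeff n f • a ^ n

theorem substMul_mul (a : R) (f g : K⟦X⟧) : substMul a (f * g) = substMul a f * substMul a g := by
  ext n
  simp only [substMul, PowerSeries.coeff_mk, PowerSeries.coeff_mul, Finset.sum_smul]
  refine Finset.sum_congr rfl fun x hx => ?_
  rw [smul_mul_smul_comm, ← pow_add, Finset.HasAntidiagonal.mem_antidiagonal.1 hx]

theorem substMul_one (a : R) : substMul a (1 : K⟦X⟧) = 1 := by
  ext n
  simp only [substMul, PowerSeries.coeff_mk, PowerSeries.coeff_one]
  split_ifs with h <;> simp [h]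

theorem substMul_pow (a : R) (f : K⟦X⟧) (k : ℕ) : substMul a (f ^ k) = substMul a f ^ k := by
  induction k with
  | zero => simp [substMul_one]
  | succ k ih => rw [pow_succ, pow_succ, substMul_mul, ih]

theorem coeff_substMul_mem (hJ : IsRingFiltration J) {a : R} (ha : a ∈ J 1) (f : K⟦X⟧) (n : ℕ) :
    PowerSeries.coeff n (substMul a f) ∈ J n := by
  rw [substMul, PowerSeries.coeff_mk]
  exact (J n).smul_mem _ (hJ.pow ha n)

/-- The truncated exponential series `∑_{n ≤ N} aⁿ/n!`. -/
def expSum (K : Type*) {R : Type*} [Field K] [Ring R] [Algebra K R] (N : ℕ) (a : R) : R :=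
  ∑ n ∈ Finset.range (N + 1), (n.factorial : K)⁻¹ • a ^ n

/-- The exponential power series. -/
def expSeries (K : Type*) [Field K] : K⟦X⟧ := PowerSeries.mk fun n => (n.factorial : K)⁻¹

/-- The power series `exp(-X)`. -/
def expNegSeries (K : Type*) [Field K] : K⟦X⟧ :=
  PowerSeries.mk fun n => (-1) ^ n * (n.factorial : K)⁻¹

theorem expSeries_eq [CharZero K] : expSeries K = PowerSeries.exp K := by
  ext n; simp [expSeries]

theorem expSeries_mul_expNegSeries [CharZero K] : expSeries K * expNegSeries K = 1 := by
  rw [← PowerSeries.exp_mul_exp_neg_eq_one, expSeries_eq]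
  congr 1
  ext n
  simp [expNegSeries, PowerSeries.evalNegHom]

theorem partialSum_substMul_expSeries (N : ℕ) (a : R) :
    partialSum N (substMul a (expSeries K)) = expSum K N a := by
  simp [partialSum, substMul, expSeries, expSum]

theorem partialSum_substMul_expNegSeries (N : ℕ) (a : R) :
    partialSum N (substMul a (expNegSeries K)) = expSum K N (-a) := by
  simp only [partialSum, substMul, expNegSeries, expSum, PowerSeries.coeff_mk]
  refine Finset.sum_congr rfl fun n _ => ?_
  rcases Nat.even_or_odd n with h | h <;> simp [h.neg_pow]

theorem expSum_mul_expSum_neg_sub_one_mem [CharZero K] (hJ : IsRingFiltration J) {a : R}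
    (ha : a ∈ J 1) (N : ℕ) : expSum K N a * expSum K N (-a) - 1 ∈ J (N + 1) := by
  have h := partialSum_mul_sub_mem hJ (coeff_substMul_mem hJ ha (expSeries K))
    (coeff_substMul_mem hJ ha (expNegSeries K)) N
  rw [← substMul_mul, expSeries_mul_expNegSeries, substMul_one, partialSum_one,
    partialSum_substMul_expSeries, partialSum_substMul_expNegSeries] at h
  simpa using neg_mem h

theorem expSum_neg_mul_expSum_sub_one_mem [CharZero K] (hJ : IsRingFiltration J) {a : R}
    (ha : a ∈ J 1) (N : ℕ) : expSum K N (-a) * expSum K N a - 1 ∈ J (N + 1) := by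
  simpa using expSum_mul_expSum_neg_sub_one_mem hJ (neg_mem ha) N

/-- The truncated logarithm series `∑_{1 ≤ n ≤ N} (-1)^{n-1} xⁿ/n`. -/
def logSum (K : Type*) {R : Type*} [Field K] [Ring R] [Algebra K R] (N : ℕ) (x : R) : R :=
  ∑ n ∈ Finset.Icc 1 N, ((-1) ^ (n - 1) * (n : K)⁻¹) • x ^ n

theorem logSum_sub_logSum_mem (hJ : IsRingFiltration J) {p : ℕ} {x y : R} (h : x - y ∈ J p)
    (N : ℕ) : logSum K N x - logSum K N y ∈ J p := by
  rw [logSum, logSum, ← Finset.sum_sub_distrib]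
  refine Submodule.sum_mem _ fun n _ => ?_
  rw [← smul_sub]
  exact (J p).smul_mem _ (hJ.pow_sub_pow h n)

/-- The derivative is a geometric sum times e^X, namely 1 - (1 - e^X)^N, and (1 - e^X)^N has order
at least N. So the truncated logarithm of e^X agrees with X up to degree N. -/
theorem coeff_logSum_expSeries_sub_one [CharZero K] {N n : ℕ} (hn : n ≤ N) :
    PowerSeries.coeff n (logSum K N (expSeries K - 1)) = if n = 1 then 1 else 0 := by
  have hc : PowerSeries.constantCoeff (1 - PowerSeries.exp K) = 0 := by simp
  have hder : PowerSeries.derivative K (logSum K N (expSeries K - 1)) =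
      1 - (1 - PowerSeries.exp K) ^ N := by
    have h1 : PowerSeries.derivative K (logSum K N (expSeries K - 1)) =
        (∑ i ∈ Finset.range N, (1 - PowerSeries.exp K) ^ i) * PowerSeries.exp K := by
      rw [logSum, map_sum, Finset.sum_mul, Finset.range_eq_Ico,
        Finset.sum_Ico_eq_sum_range, ← Finset.Ico_add_one_right_eq_Icc, Finset.sum_Ico_eq_sum_range]
      simp only [Nat.add_sub_cancel, Nat.sub_zero]
      refine Finset.sum_congr rfl fun i _ => ?_
      rw [Derivation.map_smul, PowerSeries.derivative_pow, map_sub, expSeries_eq,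
        PowerSeries.derivative_exp, PowerSeries.derivative_one, sub_zero]
      have hi : ((1 + i : ℕ) : K) ≠ 0 := Nat.cast_ne_zero.2 (by omega)
      have e : (1 - PowerSeries.exp K) ^ i = (-1) ^ i * (PowerSeries.exp K - 1) ^ i := by
        rw [← mul_pow]; ring
      have e2 : ((1 + i : ℕ) : K⟦X⟧) = PowerSeries.C ((1 + i : ℕ) : K) := by simp
      rw [zero_add, e, Nat.add_sub_cancel_left, e2, PowerSeries.smul_eq_C_mul, map_mul, map_pow,
        map_neg, map_one]
      have e3 : PowerSeries.C (((1 + i : ℕ) : K)⁻¹) * PowerSeries.C ((1 + i : ℕ) : K) = 1 := by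
        rw [← map_mul, inv_mul_cancel₀ hi, map_one]
      linear_combination ((-1) ^ i * (PowerSeries.exp K - 1) ^ i * PowerSeries.exp K) * e3
    have h2 := geom_sum_mul_neg (1 - PowerSeries.exp K) N
    rw [sub_sub_cancel] at h2
    rw [h1, h2]
  rcases n with _ | n
  · rw [logSum, map_sum]
    refine (Finset.sum_eq_zero fun i hi => ?_).trans (by simp)
    have : i ≠ 0 := by have := (Finset.mem_Icc.1 hi).1; omega
    simp [expSeries, this]
  · have h3 := congrArg (PowerSeries.coeff n) hder
    have h4 : PowerSeries.coeff n ((1 - PowerSeries.exp K) ^ N) = 0 := by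
      apply PowerSeries.coeff_of_lt_order
      refine lt_of_lt_of_le ?_ (PowerSeries.le_order_pow_of_constantCoeff_eq_zero N hc)
      exact_mod_cast hn
    rw [PowerSeries.coeff_derivative, map_sub, h4, sub_zero, PowerSeries.coeff_one] at h3
    have hn0 : ((n : K) + 1) ≠ 0 := Nat.cast_add_one_ne_zero n
    rcases Nat.eq_zero_or_pos n with rfl | h0
    · simpa using h3
    · rw [if_neg (by omega)] at h3 ⊢
      simpa [hn0] using h3

theorem partialSum_sub (N : ℕ) (q r : R⟦X⟧) :
    partialSum N (q - r) = partialSum N q - partialSum N r := by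
  simp [partialSum, Finset.sum_sub_distrib]

theorem coeff_sub_mem_filtration {q r : R⟦X⟧}
    (hq : ∀ n, PowerSeries.coeff n q ∈ J n) (hr : ∀ n, PowerSeries.coeff n r ∈ J n) (n : ℕ) :
    PowerSeries.coeff n (q - r) ∈ J n := by
  rw [map_sub]; exact (J n).sub_mem (hq n) (hr n)

theorem partialSum_sum {ι : Type*} (s : Finset ι) (N : ℕ) (q : ι → R⟦X⟧) :
    partialSum N (∑ i ∈ s, q i) = ∑ i ∈ s, partialSum N (q i) := by
  simp only [partialSum, map_sum]
  rw [Finset.sum_comm]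

theorem partialSum_smul (N : ℕ) (c : K) (q : R⟦X⟧) :
    partialSum N (c • q) = c • partialSum N q := by
  simp [partialSum, Finset.smul_sum]

theorem partialSum_logSum_sub_mem (hJ : IsRingFiltration J) {q : R⟦X⟧}
    (hq : ∀ n, PowerSeries.coeff n q ∈ J n) (N M : ℕ) :
    partialSum N (logSum K M q) - logSum K M (partialSum N q) ∈ J (N + 1) := by
  rw [logSum, logSum, partialSum_sum, ← Finset.sum_sub_distrib]
  refine Submodule.sum_mem _ fun n _ => ?_
  rw [partialSum_smul, ← smul_sub]
  exact (J _).smul_mem _ (partialSum_pow_sub_mem hJ hq N n)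

theorem substMul_logSum (a : R) (f : K⟦X⟧) (N : ℕ) :
    substMul a (logSum K N f) = logSum K N (substMul a f) := by
  ext n
  simp only [logSum, map_sum, PowerSeries.coeff_smul, ← substMul_pow]
  simp [substMul, Finset.sum_smul, mul_smul]

/-- Under X ↦ aX the series log_N(e^X - 1), where log_N is the truncated `logSum`, has N-th partial
sum exactly a, and taking partial sums commutes with log_N modulo J^{N+1}. -/
theorem logSum_expSum_sub_one_sub_mem [CharZero K] (hJ : IsRingFiltration J) {a : R}
    (ha : a ∈ J 1) {N : ℕ} (hN : 1 ≤ N) : logSum K N (expSum K N a - 1) - a ∈ J (N + 1) := by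
  have e : partialSum N (substMul a (expSeries K) - 1) = expSum K N a - 1 := by
    rw [partialSum_sub, partialSum_one, partialSum_substMul_expSeries]
  have e2 : substMul a (expSeries K) - 1 = substMul a (expSeries K - 1) := by
    rw [← substMul_one (K := K) a]; ext n; simp [substMul, sub_smul]
  have h := partialSum_logSum_sub_mem (K := K) hJ (coeff_sub_mem_filtration
    (coeff_substMul_mem hJ ha (expSeries K)) (coeff_one_mem_filtration hJ)) N N
  rw [e, e2, ← substMul_logSum] at h
  have h2 : partialSum N (substMul a (logSum K N (expSeries K - 1))) = a := by
    rw [partialSum, Finset.sum_eq_single_of_mem 1 (by simp; omega)]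
    · rw [substMul, PowerSeries.coeff_mk, coeff_logSum_expSeries_sub_one hN]; simp
    · intro n hn hn1
      rw [substMul, PowerSeries.coeff_mk,
        coeff_logSum_expSeries_sub_one (by simpa [Nat.lt_succ_iff] using hn), if_neg hn1, zero_smul]
  rw [h2] at h
  simpa using neg_mem h

end FilteredRing

/-! ### Koszul brackets and cumulants at a single element of degree zero -/

section SingleElement

variable {K R S : Type*} [Field K] [Ring R] [Algebra K R] [Ring S] [Algebra K S]

theorem orderedProd_const {n : ℕ} (p : Fin n → Prop) [DecidablePred p] (a : R) :
    orderedProd p (fun _ => a) = a ^ (Finset.univ.filter p).card := by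
  rw [orderedProd, List.map_const', List.prod_replicate]
  congr 1

theorem koszulBracket_const (Δ : R → R) (n : ℕ) (a : R) :
    koszulBracket Δ (fun _ : Fin n => 0) (fun _ => a) =
      ∑ i ∈ Finset.range (n + 1), n.choose i • ((-1) ^ (n - i) * (Δ (a ^ i) * a ^ (n - i))) := by
  have h := Finset.sum_powerset_apply_card (x := (Finset.univ : Finset (Fin n)))
    (fun i => (-1) ^ (n - i) * (Δ (a ^ i) * a ^ (n - i)))
  rw [Finset.card_fin, Finset.powerset_univ] at h
  rw [← h, koszulBracket]
  refine Finset.sum_congr rfl fun I _ => ?_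
  have h2 : (Finset.univ.filter (fun i => i ∉ I)).card = n - I.card := by
    have e : Finset.univ.filter (fun i => i ∉ I) = Iᶜ := by ext; simp
    rw [e, Finset.card_compl, Fintype.card_fin]
  simp [orderedProd_const, h2]

/-- Dividing the binomial coefficient by n! leaves 1/(i!(n-i)!), so the brackets are the
coefficients of the product of ∑ Δ(aⁱ)Xⁱ/i! and e^{-aX}. -/
theorem inv_factorial_smul_koszulBracket [CharZero K] (Δ : R → R) (n : ℕ) (a : R) :
    (n.factorial : K)⁻¹ • koszulBracket Δ (fun _ : Fin n => 0) (fun _ => a) =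
      PowerSeries.coeff n (PowerSeries.mk (fun i => (i.factorial : K)⁻¹ • Δ (a ^ i)) *
        substMul a (expNegSeries K)) := by
  rw [koszulBracket_const, PowerSeries.coeff_mul,
    Finset.Nat.sum_antidiagonal_eq_sum_range_succ_mk, Finset.smul_sum]
  refine Finset.sum_congr rfl fun i hi => ?_
  have hi' : i ≤ n := Nat.lt_succ_iff.1 (Finset.mem_range.1 hi)
  simp only [substMul, expNegSeries, PowerSeries.coeff_mk]
  rw [smul_mul_smul_comm, ← Nat.cast_smul_eq_nsmul K, smul_smul]
  have e : (-1 : R) ^ (n - i) * (Δ (a ^ i) * a ^ (n - i)) =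
      ((-1 : K) ^ (n - i)) • (Δ (a ^ i) * a ^ (n - i)) := by
    rw [Algebra.smul_def]; simp
  rw [e, smul_smul]
  congr 1
  have h1 : (n.factorial : K) ≠ 0 := Nat.cast_ne_zero.2 n.factorial_ne_zero
  have h2 : (i.factorial : K) ≠ 0 := Nat.cast_ne_zero.2 i.factorial_ne_zero
  have h3 : ((n - i).factorial : K) ≠ 0 := Nat.cast_ne_zero.2 (n - i).factorial_ne_zero
  rw [Nat.cast_choose K hi']
  field_simp

/-- The partial sums `∑_{1 ≤ n ≤ N} K(Δ)ₙ(a, …, a)/n!` of the Maurer-Cartan equation. -/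
def mcSum (Δ : R →ₗ[K] R) (N : ℕ) (a : R) : R :=
  ∑ n ∈ Finset.Icc 1 N,
    (n.factorial : K)⁻¹ • koszulBracket (fun x => Δ x) (fun _ : Fin n => 0) (fun _ => a)

theorem koszulBracket_const_mem {J : ℕ → Submodule K R} (hJ : IsRingFiltration J)
    {Δ : R →ₗ[K] R} (hΔ : ∀ p x, x ∈ J p → Δ x ∈ J p) {a : R} (ha : a ∈ J 1) (n : ℕ) :
    koszulBracket (fun x => Δ x) (fun _ : Fin n => 0) (fun _ => a) ∈ J n := by
  rw [koszulBracket_const]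
  refine Submodule.sum_mem _ fun i hi => ?_
  refine (J n).smul_of_tower_mem _ (hJ.mul_left _ (hJ.mul_le ?_ (hΔ i _ (hJ.pow ha i))
    (hJ.pow ha (n - i))))
  simp only [Finset.mem_range] at hi
  omega

theorem mcSum_sub_mcSum_mem {J : ℕ → Submodule K R} (hJ : IsRingFiltration J)
    {Δ : R →ₗ[K] R} (hΔ : ∀ p x, x ∈ J p → Δ x ∈ J p) {a : R} (ha : a ∈ J 1) {N M : ℕ}
    (h : N ≤ M) : mcSum Δ M a - mcSum Δ N a ∈ J (N + 1) := by
  induction M, h using Nat.le_induction with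
  | base => simp
  | succ M hM ih =>
    rw [mcSum, Finset.sum_Icc_succ_top (by omega), ← mcSum, add_sub_right_comm]
    exact (J _).add_mem ih ((J _).smul_mem _
      (hJ.anti (by omega) (koszulBracket_const_mem hJ hΔ ha (M + 1))))

/-- Truncated form of ∑ K(Δ)ₙ(a, …, a)/n! = Δ(e^a) e^{-a}. The missing term n = 0 is Δ(1) = 0. -/
theorem mcSum_sub_mem [CharZero K] {J : ℕ → Submodule K R} (hJ : IsRingFiltration J)
    {Δ : R →ₗ[K] R} (hΔ : ∀ p x, x ∈ J p → Δ x ∈ J p) (h1 : Δ 1 = 0) {a : R} (ha : a ∈ J 1)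
    (N : ℕ) : mcSum Δ N a - Δ (expSum K N a) * expSum K N (-a) ∈ J (N + 1) := by
  have h := partialSum_mul_sub_mem (K := K) hJ
    (q := PowerSeries.mk (fun i => (i.factorial : K)⁻¹ • Δ (a ^ i)))
    (r := substMul a (expNegSeries K))
    (fun n => by
      rw [PowerSeries.coeff_mk]; exact (J n).smul_mem _ (hΔ n _ (hJ.pow ha n)))
    (coeff_substMul_mem hJ ha _) N
  rw [partialSum_substMul_expNegSeries] at h
  have e1 : partialSum N (PowerSeries.mk (fun i => (i.factorial : K)⁻¹ • Δ (a ^ i))) =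
      Δ (expSum K N a) := by
    simp [partialSum, expSum]
  have e2 : partialSum N (PowerSeries.mk (fun i => (i.factorial : K)⁻¹ • Δ (a ^ i)) *
      substMul a (expNegSeries K)) = mcSum Δ N a := by
    rw [partialSum, mcSum, Finset.sum_range_eq_add_Ico _ (by omega),
      Finset.Ico_add_one_right_eq_Icc]
    simp only [inv_factorial_smul_koszulBracket]
    simp [h1]
  rwa [e1, e2] at h

/-- The truncated e^a and e^{-a} are mutually inverse modulo J^{N+1}, so the factor e^{-a} can be
cancelled. This makes the Maurer–Cartan equation linear in e^a. -/
theorem mcSum_mem_iff [CharZero K] {J : ℕ → Submodule K R} (hJ : IsRingFiltration J)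
    {Δ : R →ₗ[K] R} (hΔ : ∀ p x, x ∈ J p → Δ x ∈ J p) (h1 : Δ 1 = 0) {a : R} (ha : a ∈ J 1)
    (N : ℕ) : mcSum Δ N a ∈ J (N + 1) ↔ Δ (expSum K N a) ∈ J (N + 1) := by
  have h := mcSum_sub_mem hJ hΔ h1 ha N
  have e : mcSum Δ N a ∈ J (N + 1) ↔ Δ (expSum K N a) * expSum K N (-a) ∈ J (N + 1) :=
    ⟨fun h' => by simpa using (J _).sub_mem h' h, fun h' => by simpa using (J _).add_mem h h'⟩
  rw [e]
  refine ⟨fun h' => ?_, fun h' => hJ.mul_right _ h'⟩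
  have h2 := (J _).sub_mem (hJ.mul_right (expSum K N a) h')
    (hJ.mul_left (Δ (expSum K N a)) (expSum_neg_mul_expSum_sub_one_mem (K := K) hJ ha N))
  rwa [mul_sub, mul_assoc, sub_sub_cancel, mul_one] at h2

theorem apply_expSum_sub_mem [CharZero K] {J : ℕ → Submodule K R} (hJ : IsRingFiltration J)
    {Δ : R →ₗ[K] R} (hΔ : ∀ p x, x ∈ J p → Δ x ∈ J p) (h1 : Δ 1 = 0) {a : R} (ha : a ∈ J 1)
    (N : ℕ) : Δ (expSum K N a) - mcSum Δ N a * expSum K N a ∈ J (N + 1) := by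
  have h := hJ.mul_right (expSum K N a) (mcSum_sub_mem hJ hΔ h1 ha N)
  have h2 := hJ.mul_left (Δ (expSum K N a)) (expSum_neg_mul_expSum_sub_one_mem (K := K) hJ ha N)
  have h3 := neg_mem ((J _).add_mem h h2)
  convert h3 using 1
  noncomm_ring

/-- First-order expansion at a in the direction x. For n ≥ 2 each monomial that involves x has at
least one further factor from J¹, so only the linear bracket K₁ = Δ contributes modulo J^{p+1}. -/
theorem mcSum_add_sub_mem {J : ℕ → Submodule K R} (hJ : IsRingFiltration J)
    {Δ : R →ₗ[K] R} (hΔ : ∀ p x, x ∈ J p → Δ x ∈ J p) (h1 : Δ 1 = 0) {a x : R} (ha : a ∈ J 1)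
    {p : ℕ} (hp : 1 ≤ p) (hx : x ∈ J p) {N : ℕ} (hN : 1 ≤ N) :
    mcSum Δ N (a + x) - mcSum Δ N a - Δ x ∈ J (p + 1) := by
  have key : ∀ n, 2 ≤ n →
      koszulBracket (fun x => Δ x) (fun _ : Fin n => 0) (fun _ => a + x) -
        koszulBracket (fun x => Δ x) (fun _ : Fin n => 0) (fun _ => a) ∈ J (p + 1) := by
    intro n hn
    rw [koszulBracket_const, koszulBracket_const, ← Finset.sum_sub_distrib]
    refine Submodule.sum_mem _ fun i hi => ?_
    simp only [Finset.mem_range] at hi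
    rw [← smul_sub, ← mul_sub]
    refine (J _).smul_of_tower_mem _ (hJ.mul_left _ ?_)
    have e : Δ ((a + x) ^ i) * (a + x) ^ (n - i) - Δ (a ^ i) * a ^ (n - i) =
        Δ ((a + x) ^ i - a ^ i) * (a + x) ^ (n - i) +
          Δ (a ^ i) * ((a + x) ^ (n - i) - a ^ (n - i)) := by
      rw [map_sub]; noncomm_ring
    rw [e]
    exact (J _).add_mem
      (hJ.mul_le (by omega) (hΔ _ _ (hJ.add_pow_sub_pow ha hp hx i))
        (hJ.pow ((J 1).add_mem ha (hJ.anti hp hx)) (n - i)))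
      (hJ.mul_le (by omega) (hΔ _ _ (hJ.pow ha i)) (hJ.add_pow_sub_pow ha hp hx (n - i)))
  have hone : ∀ y : R, koszulBracket (fun x => Δ x) (fun _ : Fin 1 => 0) (fun _ => y) = Δ y := by
    intro y
    simp [koszulBracket_const, Finset.sum_range_succ, h1]
  have split : ∀ y : R, mcSum Δ N y = Δ y + ∑ n ∈ Finset.Ico 2 (N + 1),
      (n.factorial : K)⁻¹ • koszulBracket (fun x => Δ x) (fun _ : Fin n => 0) (fun _ => y) := by
    intro y
    rw [mcSum, ← Finset.Ico_add_one_right_eq_Icc, Finset.sum_eq_sum_Ico_succ_bot (by omega), hone]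
    simp
  rw [split, split, map_add]
  have e : ∀ u v : R, Δ a + Δ x + u - (Δ a + v) - Δ x = u - v := by intros; abel
  rw [e, ← Finset.sum_sub_distrib]
  refine Submodule.sum_mem _ fun n hn => ?_
  rw [← smul_sub]
  exact (J _).smul_mem _ (key n (Finset.mem_Ico.1 hn).1)

/-- The generating function of the moments of `g`. -/
def momentSeries (K : Type*) {S : Type*} [Field K] [Ring S] [Algebra K S] (g : ℕ → S) : S⟦X⟧ :=
  PowerSeries.mk fun m => (m.factorial : K)⁻¹ • g m

/-- Exponential formula: a map to {1, …, k} is an ordered partition into possibly empty blocks, and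
splitting off the first block corresponds to one factor of the generating function. The index type
is arbitrary because the induction passes to the complement of a block. -/
theorem sum_prod_card_fiber [CharZero K] (g : ℕ → S) (k : ℕ) (ι : Type) [Fintype ι]
    [DecidableEq ι] :
    ∑ c : ι → Fin k, ((List.finRange k).map fun l =>
        g (Finset.univ.filter fun i => c i = l).card).prod =
      ((Fintype.card ι).factorial : K) •
        PowerSeries.coeff (Fintype.card ι) (momentSeries K g ^ k) := by
  induction k generalizing ι with
  | zero =>
    rw [pow_zero, PowerSeries.coeff_one]
    rcases isEmpty_or_nonempty ι with h | h
    · simp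
    · have : IsEmpty (ι → Fin 0) := ⟨fun c => (c (Classical.arbitrary ι)).elim0⟩
      simp
  | succ k ih =>
    rw [← Finset.sum_fiberwise Finset.univ
      (fun c : ι → Fin (k + 1) => Finset.univ.filter fun i => c i = 0)]
    have step : ∀ I : Finset ι,
        ∑ c : ι → Fin (k + 1) with (Finset.univ.filter fun i => c i = 0) = I,
          ((List.finRange (k + 1)).map fun l =>
            g (Finset.univ.filter fun i => c i = l).card).prod =
        g I.card * (((Fintype.card ι - I.card).factorial : K) •
          PowerSeries.coeff (Fintype.card ι - I.card) (momentSeries K g ^ k)) := by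
      intro I
      have hcard : Fintype.card {i // i ∉ I} = Fintype.card ι - I.card := by
        rw [Fintype.card_subtype_compl, Fintype.card_coe]
      rw [← hcard, ← ih {i // i ∉ I}, Finset.mul_sum]
      symm
      -- Maps whose fibre over 0 is I correspond to maps from the complement of I to the remaining k
      -- labels.
      refine Finset.sum_bij
        (fun c' _ i => if hi : i ∈ I then 0 else Fin.succ (c' ⟨i, hi⟩)) ?_ ?_ ?_ ?_
      · intro c' _
        simp only [Finset.mem_filter, Finset.mem_univ, true_and]
        ext i
        by_cases hi : i ∈ I <;> simp [hi, Fin.succ_ne_zero]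
      · intro c₁ _ c₂ _ h
        ext ⟨i, hi⟩
        have := congrFun h i
        simp only [hi, dite_false, Fin.succ_inj] at this
        rw [this]
      · intro c hc
        simp only [Finset.mem_filter, Finset.mem_univ, true_and] at hc
        have hI : ∀ i, i ∈ I ↔ c i = 0 := fun i => by rw [← hc]; simp
        refine ⟨fun i => (c i).pred fun h => i.2 ((hI i).2 h), Finset.mem_univ _, ?_⟩
        ext i
        by_cases hi : i ∈ I
        · simp [hi, (hI i).1 hi]
        · simp [hi]
      · intro c' _
        rw [List.finRange_succ, List.map_cons, List.prod_cons, List.map_map]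
        have h0 : (Finset.univ.filter fun i =>
            (if hi : i ∈ I then (0 : Fin (k + 1)) else Fin.succ (c' ⟨i, hi⟩)) = 0) = I := by
          ext i
          by_cases hi : i ∈ I <;> simp [hi, Fin.succ_ne_zero]
        rw [h0]
        congr 3
        ext l
        simp only [Function.comp_apply]
        congr 1
        rw [← Finset.card_map (Function.Embedding.subtype _)]
        congr 1
        ext i
        by_cases hi : i ∈ I <;> simp [hi, (Fin.succ_ne_zero _).symm]
    rw [Finset.sum_congr rfl fun I _ => step I]
    have h := Finset.sum_powerset_apply_card (x := (Finset.univ : Finset ι))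
      (fun j => g j * (((Fintype.card ι - j).factorial : K) •
        PowerSeries.coeff (Fintype.card ι - j) (momentSeries K g ^ k)))
    rw [Finset.powerset_univ, Finset.card_univ] at h
    rw [h, pow_succ', PowerSeries.coeff_mul, Finset.Nat.sum_antidiagonal_eq_sum_range_succ_mk,
      Finset.smul_sum]
    refine Finset.sum_congr rfl fun j hj => ?_
    have hj' : j ≤ Fintype.card ι := Nat.lt_succ_iff.1 (Finset.mem_range.1 hj)
    rw [momentSeries, PowerSeries.coeff_mk, ← momentSeries, ← Nat.cast_smul_eq_nsmul K,
      mul_smul_comm, smul_mul_assoc, smul_smul, smul_smul]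
    congr 1
    have h2 : (j.factorial : K) ≠ 0 := Nat.cast_ne_zero.2 j.factorial_ne_zero
    have h3 : ((Fintype.card ι - j).factorial : K) ≠ 0 :=
      Nat.cast_ne_zero.2 (Nat.factorial_ne_zero _)
    rw [Nat.cast_choose K hj']
    field_simp

theorem coeff_pow_eq_zero_of_lt {q : S⟦X⟧} (hq : PowerSeries.constantCoeff q = 0) {n k : ℕ}
    (h : n < k) : PowerSeries.coeff n (q ^ k) = 0 := by
  apply PowerSeries.coeff_of_lt_order
  exact lt_of_lt_of_le (by exact_mod_cast h)
    (PowerSeries.le_order_pow_of_constantCoeff_eq_zero k hq)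

/-- Setting the zeroth moment to 0 kills all maps with an empty fibre, so the sum over surjections
becomes a sum over all maps. The weight (k-1)!/k! = 1/k is that of the logarithm. -/
theorem inv_factorial_smul_cumulant {R : Type*} [Ring R] [CharZero K] (f : R → S) (b : R) {n N : ℕ} (hn : n ≤ N) :
    (n.factorial : K)⁻¹ • cumulant K f (fun _ : Fin n => 0) (fun _ => b) =
      PowerSeries.coeff n
        (logSum K N (momentSeries K fun m => if m = 0 then 0 else f (b ^ m))) := by
  set g : ℕ → S := fun m => if m = 0 then 0 else f (b ^ m) with hg
  have hc : PowerSeries.constantCoeff (momentSeries K g) = 0 := by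
    rw [← PowerSeries.coeff_zero_eq_constantCoeff_apply]
    simp [momentSeries, hg]
  have h1 : ∀ k, ∑ c : Fin n → Fin k,
      (if Function.Surjective c then
        ((k.factorial : K)⁻¹ * ((-1 : K) ^ (k - 1) * ((k - 1).factorial : K))) •
        ((∑ i : Fin n, ∑ j : Fin n,
            if i < j ∧ c j < c i then (0 : ℤ) * 0 else 0).negOnePow •
          ((List.finRange k).map
            (fun l => f (orderedProd (fun i => c i = l) fun _ => b))).prod)
      else 0) = ((k.factorial : K)⁻¹ * ((-1 : K) ^ (k - 1) * ((k - 1).factorial : K))) •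
        ((n.factorial : K) • PowerSeries.coeff n (momentSeries K g ^ k)) := by
    intro k
    have h2 := sum_prod_card_fiber (K := K) g k (Fin n)
    rw [Fintype.card_fin] at h2
    rw [← h2, Finset.smul_sum]
    refine Finset.sum_congr rfl fun c _ => ?_
    split_ifs with hs
    · have hz : (∑ i : Fin n, ∑ j : Fin n,
            if i < j ∧ c j < c i then (0 : ℤ) * 0 else 0) = 0 := by simp
      rw [hz, Int.negOnePow_zero, one_smul]
      congr 3
      ext l
      obtain ⟨i, hi⟩ := hs l
      have : (Finset.univ.filter fun i => c i = l).card ≠ 0 := by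
        rw [Finset.card_ne_zero]
        exact ⟨i, by simp [hi]⟩
      simp only [hg, this, if_false, orderedProd_const]
    · rw [Function.Surjective] at hs
      push Not at hs
      obtain ⟨l, hl⟩ := hs
      rw [List.prod_eq_zero, smul_zero]
      refine List.mem_map.2 ⟨l, List.mem_finRange l, ?_⟩
      have : (Finset.univ.filter fun i => c i = l).card = 0 := by
        rw [Finset.card_eq_zero, Finset.filter_eq_empty_iff]
        exact fun i _ => hl i
      simp [hg, this]
  -- The range k ≤ n may be enlarged to k ≤ N because the k-th power of a series without constant
  -- term has order at least k.
  rw [cumulant, Finset.sum_congr rfl fun k _ => h1 k, logSum, map_sum,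
    ← Finset.sum_subset (Finset.Icc_subset_Icc_right hn), Finset.smul_sum]
  · refine Finset.sum_congr rfl fun k hk => ?_
    have hk0 : 1 ≤ k := (Finset.mem_Icc.1 hk).1
    rw [PowerSeries.coeff_smul, smul_smul, smul_smul]
    congr 1
    have e : k.factorial = k * (k - 1).factorial := (Nat.mul_factorial_pred (by omega)).symm
    have h2 : (n.factorial : K) ≠ 0 := Nat.cast_ne_zero.2 n.factorial_ne_zero
    have h3 : ((k - 1).factorial : K) ≠ 0 := Nat.cast_ne_zero.2 (Nat.factorial_ne_zero _)
    have h4 : (k : K) ≠ 0 := Nat.cast_ne_zero.2 (by omega)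
    rw [e, Nat.cast_mul]
    field_simp
  · intro k hk hk'
    simp only [Finset.mem_Icc] at hk hk'
    rw [PowerSeries.coeff_smul, coeff_pow_eq_zero_of_lt hc (by omega), smul_zero]

/-- The partial sums `∑_{1 ≤ n ≤ N} κ(f)ₙ(b, …, b)/n!` of the push-forward of `b`. -/
def cumulantSum (K : Type*) {R S : Type*} [Field K] [Ring R] [Ring S] [Module K S]
    (f : R → S) (N : ℕ) (b : R) : S :=
  ∑ n ∈ Finset.Icc 1 N,
    (n.factorial : K)⁻¹ • cumulant K f (fun _ : Fin n => 0) (fun _ => b)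

theorem cumulantSum_sub_logSum_mem [CharZero K] {J : ℕ → Submodule K R} {I : ℕ → Submodule K S}
    (hJ : IsRingFiltration J) (hI : IsRingFiltration I) {f : R →ₗ[K] S}
    (hf : ∀ p x, x ∈ J p → f x ∈ I p) (h1 : f 1 = 1) {b : R} (hb : b ∈ J 1) (N : ℕ) :
    cumulantSum K (fun x => f x) N b - logSum K N (f (expSum K N b) - 1) ∈ I (N + 1) := by
  set q : S⟦X⟧ := momentSeries K fun m => if m = 0 then 0 else f (b ^ m) with hq
  have hqI : ∀ n, PowerSeries.coeff n q ∈ I n := by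
    intro n
    rw [hq, momentSeries, PowerSeries.coeff_mk]
    refine (I n).smul_mem _ ?_
    split_ifs
    · exact zero_mem _
    · exact hf n _ (hJ.pow hb n)
  have e1 : partialSum N q = f (expSum K N b) - 1 := by
    rw [partialSum, expSum, Finset.sum_range_succ', Finset.sum_range_succ']
    simp [hq, momentSeries, h1]
  have e2 : cumulantSum K (fun x => f x) N b = partialSum N (logSum K N q) := by
    rw [partialSum, cumulantSum, Finset.sum_range_eq_add_Ico _ (by omega),
      Finset.Ico_add_one_right_eq_Icc, ← inv_factorial_smul_cumulant _ _ (Nat.zero_le N)]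
    have e3 : cumulant K (fun x => f x) (fun _ : Fin 0 => 0) (fun _ => b) = 0 := by
      simp [cumulant]
    rw [e3, smul_zero, zero_add]
    refine Finset.sum_congr rfl fun n hn => ?_
    exact inv_factorial_smul_cumulant _ _ (Finset.mem_Icc.1 hn).2
  rw [e2, ← e1]
  exact partialSum_logSum_sub_mem hI hqI N N

/-- The cumulant series is log f(e^b), so comparing f(e^b) with e^a suffices to identify the
push-forward. -/
theorem cumulantSum_sub_mem [CharZero K] {J : ℕ → Submodule K R} {I : ℕ → Submodule K S}
    (hJ : IsRingFiltration J) (hI : IsRingFiltration I) {f : R →ₗ[K] S}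
    (hf : ∀ p x, x ∈ J p → f x ∈ I p) (h1 : f 1 = 1) {b : R} (hb : b ∈ J 1) {a : S}
    (ha : a ∈ I 1) {N : ℕ} (hN : 1 ≤ N) (h : f (expSum K N b) - expSum K N a ∈ I (N + 1)) :
    cumulantSum K (fun x => f x) N b - a ∈ I (N + 1) := by
  have h2 := logSum_sub_logSum_mem hI (x := f (expSum K N b) - 1) (y := expSum K N a - 1)
    (by simpa using h) N
  have h3 := (I _).add_mem ((I _).add_mem (cumulantSum_sub_logSum_mem hJ hI hf h1 hb N) h2)
    (logSum_expSum_sub_one_sub_mem hI ha hN)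
  simpa using h3

end SingleElement

/-! ### Laurent series -/

section LaurentLinear

variable {K M N P : Type*} [Field K] [AddCommGroup M] [Module K M] [AddCommGroup N] [Module K N]
  [AddCommGroup P] [Module K P]

/-- The Laurent series whose coefficients lie in prescribed subspaces. -/
def coeffIn (S : ℤ → Submodule K M) : Submodule K (LaurentSeries M) where
  carrier := {x | ∀ m, x.coeff m ∈ S m}
  add_mem' hx hy m := by
    rw [HahnSeries.coeff_add]; exact (S m).add_mem (hx m) (hy m)
  zero_mem' m := by rw [HahnSeries.coeff_zero]; exact zero_mem _
  smul_mem' c x hx m := by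
    rw [HahnSeries.coeff_smul]; exact (S m).smul_mem c (hx m)

theorem mem_coeffIn {S : ℤ → Submodule K M} {x : LaurentSeries M} :
    x ∈ coeffIn S ↔ ∀ m, x.coeff m ∈ S m := Iff.rfl

/-- The Laurent series of order at least `s`. -/
def orderGE (K M : Type*) [Field K] [AddCommGroup M] [Module K M] (s : ℤ) :
    Submodule K (LaurentSeries M) :=
  coeffIn fun m => if m < s then ⊥ else ⊤

theorem mem_orderGE {s : ℤ} {x : LaurentSeries M} :
    x ∈ orderGE K M s ↔ ∀ m, m < s → x.coeff m = 0 := by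
  rw [orderGE, mem_coeffIn]
  refine forall_congr' fun m => ?_
  split_ifs with h <;> simp [h]

theorem orderGE_anti {s s' : ℤ} (h : s ≤ s') : orderGE K M s' ≤ orderGE K M s := by
  intro x hx
  rw [mem_orderGE] at hx ⊢
  exact fun m hm => hx m (by omega)

theorem exists_coeff_sub_eq_zero (x : LaurentSeries M) (m : ℤ) :
    ∃ n₀ : ℕ, ∀ n : ℕ, n₀ ≤ n → x.coeff (m - n) = 0 :=
  ⟨(m - x.order + 1).toNat, fun n hn => HahnSeries.coeff_eq_zero_of_lt_order (by omega)⟩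

theorem laurentExt_coeff_eq_sum (f : ℕ → (M →ₗ[K] N)) {x : LaurentSeries M} {m : ℤ} {n₀ : ℕ}
    (h : ∀ n : ℕ, n₀ ≤ n → x.coeff (m - n) = 0) :
    (laurentExt f x).coeff m = ∑ n ∈ Finset.range n₀, f n (x.coeff (m - n)) := by
  rw [laurentExt_coeff]
  refine finsum_eq_sum_of_support_subset _ fun n hn => ?_
  by_contra hlt
  simp only [Finset.coe_range, Set.mem_Iio, not_lt] at hlt
  exact hn (by simp only [h n hlt, map_zero])

/-- The `K((t))`-linear extension as a `K`-linear map. -/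
def laurentLin (f : ℕ → (M →ₗ[K] N)) : LaurentSeries M →ₗ[K] LaurentSeries N where
  toFun := laurentExt f
  map_add' x y := by
    ext m
    obtain ⟨n₁, h₁⟩ := exists_coeff_sub_eq_zero x m
    obtain ⟨n₂, h₂⟩ := exists_coeff_sub_eq_zero y m
    rw [HahnSeries.coeff_add,
      laurentExt_coeff_eq_sum f (x := x) (n₀ := max n₁ n₂) fun n hn => h₁ n (by omega),
      laurentExt_coeff_eq_sum f (x := y) (n₀ := max n₁ n₂) fun n hn => h₂ n (by omega),
      laurentExt_coeff_eq_sum f (x := x + y) (n₀ := max n₁ n₂) fun n hn => by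
        rw [HahnSeries.coeff_add, h₁ n (by omega), h₂ n (by omega), add_zero],
      ← Finset.sum_add_distrib]
    simp
  map_smul' c x := by
    ext m
    obtain ⟨n₁, h₁⟩ := exists_coeff_sub_eq_zero x m
    rw [RingHom.id_apply, HahnSeries.coeff_smul, laurentExt_coeff_eq_sum f h₁,
      laurentExt_coeff_eq_sum f (x := c • x) (n₀ := n₁) fun n hn => by
        rw [HahnSeries.coeff_smul, h₁ n hn, smul_zero],
      Finset.smul_sum]
    simp

theorem laurentLin_apply (f : ℕ → (M →ₗ[K] N)) (x : LaurentSeries M) :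
    laurentLin f x = laurentExt f x := rfl

theorem laurentLin_mem_coeffIn {f : ℕ → (M →ₗ[K] N)} {S : ℤ → Submodule K M}
    {S' : ℤ → Submodule K N} (h : ∀ (n : ℕ) (m : ℤ) (x : M), x ∈ S (m - n) → f n x ∈ S' m)
    {x : LaurentSeries M} (hx : x ∈ coeffIn S) : laurentLin f x ∈ coeffIn S' := by
  intro m
  obtain ⟨n₁, h₁⟩ := exists_coeff_sub_eq_zero x m
  rw [laurentLin_apply, laurentExt_coeff_eq_sum f h₁]
  exact Submodule.sum_mem _ fun n _ => h n m _ (hx _)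

theorem laurentLin_mem_orderGE (f : ℕ → (M →ₗ[K] N)) {s : ℤ} {x : LaurentSeries M}
    (hx : x ∈ orderGE K M s) : laurentLin f x ∈ orderGE K N s := by
  refine laurentLin_mem_coeffIn (fun n m y hy => ?_) hx
  split_ifs with hm
  · rw [if_pos (by omega)] at hy
    rw [(Submodule.mem_bot K).1 hy, map_zero]
    exact zero_mem _
  · exact Submodule.mem_top

/-- The coefficientwise extension of a linear map to Laurent series. -/
def coeffLin (g : M →ₗ[K] N) : LaurentSeries M →ₗ[K] LaurentSeries N where
  toFun x := HahnSeries.map x g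
  map_add' x y := by ext; simp
  map_smul' c x := by ext; simp

@[simp]
theorem coeffLin_coeff (g : M →ₗ[K] N) (x : LaurentSeries M) (m : ℤ) :
    (coeffLin g x).coeff m = g (x.coeff m) := rfl

theorem coeffLin_mem_coeffIn {g : M →ₗ[K] N} {S : ℤ → Submodule K M} {S' : ℤ → Submodule K N}
    (h : ∀ (m : ℤ) (x : M), x ∈ S m → g x ∈ S' m) {x : LaurentSeries M} (hx : x ∈ coeffIn S) :
    coeffLin g x ∈ coeffIn S' :=
  fun m => h m _ (hx m)

theorem coeffLin_mem_orderGE (g : M →ₗ[K] N) {s : ℤ} {x : LaurentSeries M}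
    (hx : x ∈ orderGE K M s) : coeffLin g x ∈ orderGE K N s := by
  rw [mem_orderGE] at hx ⊢
  intro m hm
  rw [coeffLin_coeff, hx m hm, map_zero]

theorem laurentLin_comp_left (g : N →ₗ[K] P) (f : ℕ → (M →ₗ[K] N)) :
    laurentLin (fun m => g ∘ₗ f m) = coeffLin g ∘ₗ laurentLin f := by
  ext x m
  obtain ⟨n₁, h₁⟩ := exists_coeff_sub_eq_zero x m
  rw [LinearMap.comp_apply, coeffLin_coeff, laurentLin_apply, laurentLin_apply,
    laurentExt_coeff_eq_sum _ h₁, laurentExt_coeff_eq_sum _ h₁, map_sum]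
  rfl

theorem laurentLin_comp_right (f : ℕ → (N →ₗ[K] P)) (g : M →ₗ[K] N) :
    laurentLin (fun m => f m ∘ₗ g) = laurentLin f ∘ₗ coeffLin g := rfl

theorem laurentLin_add (f g : ℕ → (M →ₗ[K] N)) :
    laurentLin (fun m => f m + g m) = laurentLin f + laurentLin g := by
  ext x m
  obtain ⟨n₁, h₁⟩ := exists_coeff_sub_eq_zero x m
  rw [LinearMap.add_apply, HahnSeries.coeff_add, laurentLin_apply, laurentLin_apply,
    laurentLin_apply, laurentExt_coeff_eq_sum _ h₁, laurentExt_coeff_eq_sum _ h₁,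
    laurentExt_coeff_eq_sum _ h₁, ← Finset.sum_add_distrib]
  rfl

theorem laurentLin_ite_zero (g : M →ₗ[K] N) :
    laurentLin (fun m => if m = 0 then g else 0) = coeffLin g := by
  ext x m
  rw [coeffLin_coeff, laurentLin_apply, laurentExt_coeff, finsum_eq_single _ 0]
  · simp
  · intro n hn; simp [hn]

/-- The action of `K[[t]]`-linear endomorphisms of `M[[t]]` on `M((t))`. -/
def laurentHom (K M : Type*) [Field K] [AddCommGroup M] [Module K M] :
    (Module.End K M)⟦X⟧ →+* Module.End K (LaurentSeries M) where
  toFun p := laurentLin fun n => PowerSeries.coeff n p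
  map_one' := by
    simp only [PowerSeries.coeff_one]
    rw [laurentLin_ite_zero]
    rfl
  map_zero' := by
    ext x m
    simp [laurentLin_apply, laurentExt_coeff]
  map_add' p q := by
    simp only [map_add]
    exact laurentLin_add _ _
  map_mul' p q := by
    ext x m
    obtain ⟨n₀, h₀⟩ := exists_coeff_sub_eq_zero x m
    have hq : ∀ n : ℕ, (laurentExt (fun n => PowerSeries.coeff n q) x).coeff (m - n) =
        ∑ l ∈ Finset.range (n₀ - n), PowerSeries.coeff l q (x.coeff (m - (n + l : ℕ))) := by
      intro n
      rw [laurentExt_coeff_eq_sum _ (n₀ := n₀ - n) fun l hl => ?_]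
      · refine Finset.sum_congr rfl fun l _ => ?_
        rw [Nat.cast_add, sub_sub]
      · rw [sub_sub, ← Nat.cast_add]
        exact h₀ _ (by omega)
    rw [Module.End.mul_apply, laurentLin_apply, laurentLin_apply, laurentLin_apply,
      laurentExt_coeff_eq_sum _ h₀, laurentExt_coeff_eq_sum _ (n₀ := n₀) fun n hn => by
        rw [hq, Nat.sub_eq_zero_of_le hn, Finset.range_zero, Finset.sum_empty]]
    simp only [hq, map_sum]
    -- Since x vanishes below a fixed order, only pairs (n, l) with n + l < n₀ occur. Summing them
    -- along diagonals gives the Cauchy product.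
    rw [← Finset.sum_range_diag_flip n₀ fun n l =>
      PowerSeries.coeff n p (PowerSeries.coeff l q (x.coeff (m - (n + l : ℕ))))]
    refine Finset.sum_congr rfl fun n _ => ?_
    rw [PowerSeries.coeff_mul, Finset.Nat.sum_antidiagonal_eq_sum_range_succ_mk,
      LinearMap.sum_apply]
    refine Finset.sum_congr rfl fun l hl => ?_
    rw [Nat.add_sub_cancel' (Nat.lt_succ_iff.1 (Finset.mem_range.1 hl))]
    rfl

theorem laurentHom_apply (p : (Module.End K M)⟦X⟧) :
    laurentHom K M p = laurentLin fun n => PowerSeries.coeff n p := rfl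

theorem laurentHom_C (g : Module.End K M) : laurentHom K M (PowerSeries.C g) = coeffLin g := by
  rw [laurentHom_apply, ← laurentLin_ite_zero]
  simp only [PowerSeries.coeff_C]

end LaurentLinear

/-! ### Orders and coefficient conditions of products of Laurent series -/

section LaurentRing

variable {K A : Type*} [Field K] [Ring A] [Algebra K A]

theorem mul_mem_coeffIn {S S' S'' : ℤ → Submodule K A}
    (h : ∀ (m m' : ℤ) (x y : A), x ∈ S m → y ∈ S' m' → x * y ∈ S'' (m + m'))
    {x y : LaurentSeries A} (hx : x ∈ coeffIn S) (hy : y ∈ coeffIn S') : x * y ∈ coeffIn S'' := by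
  intro m
  rw [HahnSeries.coeff_mul]
  refine Submodule.sum_mem _ fun ij hij => ?_
  have := h _ _ _ _ (hx ij.1) (hy ij.2)
  rwa [(Finset.mem_antidiagonal.1 hij).2.2] at this

theorem mul_mem_orderGE {s s' r : ℤ} (hr : r ≤ s + s') {x y : LaurentSeries A}
    (hx : x ∈ orderGE K A s) (hy : y ∈ orderGE K A s') : x * y ∈ orderGE K A r := by
  refine mul_mem_coeffIn (fun m m' x y hx hy => ?_) hx hy
  split_ifs at hx hy ⊢ with h1 h2 h3 h4 <;> simp_all
  omega

theorem pow_mem_orderGE {x : LaurentSeries A} (hx : x ∈ orderGE K A (-1)) (n : ℕ) :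
    x ^ n ∈ orderGE K A (-n) := by
  induction n with
  | zero =>
    rw [mem_orderGE]
    intro m hm
    rw [pow_zero, HahnSeries.coeff_one, if_neg (by simp at hm; omega)]
  | succ n ih => rw [pow_succ]; exact mul_mem_orderGE (by push_cast; omega) ih hx

theorem pow_sub_pow_mem_orderGE {x y : LaurentSeries A} (hx : x ∈ orderGE K A (-1))
    (hy : y ∈ orderGE K A (-1)) {s : ℤ} (h : x - y ∈ orderGE K A s) (n : ℕ) :
    x ^ n - y ^ n ∈ orderGE K A (s - n + 1) := by
  induction n with
  | zero => simp
  | succ n ih =>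
    have e : x ^ (n + 1) - y ^ (n + 1) = x ^ n * (x - y) + (x ^ n - y ^ n) * y := by
      rw [pow_succ, pow_succ]; noncomm_ring
    rw [e]
    exact (orderGE K A _).add_mem (mul_mem_orderGE (by push_cast; omega) (pow_mem_orderGE hx n) h)
      (mul_mem_orderGE (by push_cast; omega) ih hy)

end LaurentRing

/-! ### Koszul brackets of Laurent series -/

section KoszulLaurent

variable {K A : Type*} [Field K] [Ring A] [Algebra K A]

theorem orderedProd_eq_prod_ofFn {R : Type*} [Ring R] {n : ℕ} (p : Fin n → Prop)
    [DecidablePred p] (v : Fin n → R) :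
    orderedProd p v = (List.ofFn fun i => if p i then v i else 1).prod := by
  rw [orderedProd, List.ofFn_eq_map]
  induction List.finRange n with
  | nil => rfl
  | cons i l ih =>
    by_cases h : p i <;> simp [h, ih]

theorem orderedProd_update_of_neg {R : Type*} [Ring R] {n : ℕ} (p : Fin n → Prop)
    [DecidablePred p] [DecidableEq (Fin n)] (v : Fin n → R) {i : Fin n} (hi : ¬ p i) (x : R) :
    orderedProd p (Function.update v i x) = orderedProd p v := by
  rw [orderedProd_eq_prod_ofFn, orderedProd_eq_prod_ofFn]
  congr 2
  ext j
  rcases eq_or_ne j i with rfl | h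
  · simp [hi]
  · simp [h]

theorem orderedProd_update_of_pos (K : Type*) {R : Type*} [Field K] [Ring R] [Algebra K R]
    {n : ℕ} (p : Fin n → Prop) [DecidablePred p] [DecidableEq (Fin n)] (v : Fin n → R)
    {i : Fin n} (hi : p i) (x : R) :
    orderedProd p (Function.update v i x) = MultilinearMap.mkPiAlgebraFin K n R
      (Function.update (fun j => if p j then v j else 1) i x) := by
  rw [orderedProd_eq_prod_ofFn, MultilinearMap.mkPiAlgebraFin_apply]
  congr 2
  ext j
  rcases eq_or_ne j i with rfl | h
  · simp [hi]
  · simp [h]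

/-- The Koszul bracket without signs, as a multilinear map. -/
def koszulMultilinear {R : Type*} [Ring R] [Algebra K R] (Δ : R →ₗ[K] R) (n : ℕ) :
    MultilinearMap K (fun _ : Fin n => R) R :=
  MultilinearMap.mk' (fun v => koszulBracket (fun x => Δ x) (fun _ => 0) v)
  (fun v i x y => by
    have key : ∀ I : Finset (Fin n),
        Δ (orderedProd (fun j => j ∈ I) (Function.update v i (x + y))) *
          orderedProd (fun j => j ∉ I) (Function.update v i (x + y)) =
        Δ (orderedProd (fun j => j ∈ I) (Function.update v i x)) *
          orderedProd (fun j => j ∉ I) (Function.update v i x) +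
        Δ (orderedProd (fun j => j ∈ I) (Function.update v i y)) *
          orderedProd (fun j => j ∉ I) (Function.update v i y) := by
      intro I
      by_cases hi : i ∈ I
      · simp only [orderedProd_update_of_neg (fun j => j ∉ I) v (not_not.2 hi),
          orderedProd_update_of_pos K (fun j => j ∈ I) v hi, MultilinearMap.map_update_add,
          map_add, add_mul]
      · simp only [orderedProd_update_of_neg (fun j => j ∈ I) v hi,
          orderedProd_update_of_pos K (fun j => j ∉ I) v hi, MultilinearMap.map_update_add,
          mul_add]
    simp only [koszulBracket, key, mul_add, smul_add, Finset.sum_add_distrib])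
  (fun v i c x => by
    have key : ∀ I : Finset (Fin n),
        Δ (orderedProd (fun j => j ∈ I) (Function.update v i (c • x))) *
          orderedProd (fun j => j ∉ I) (Function.update v i (c • x)) =
        c • (Δ (orderedProd (fun j => j ∈ I) (Function.update v i x)) *
          orderedProd (fun j => j ∉ I) (Function.update v i x)) := by
      intro I
      by_cases hi : i ∈ I
      · simp only [orderedProd_update_of_neg (fun j => j ∉ I) v (not_not.2 hi),
          orderedProd_update_of_pos K (fun j => j ∈ I) v hi, MultilinearMap.map_update_smul,
          map_smul, smul_mul_assoc]
      · simp only [orderedProd_update_of_neg (fun j => j ∈ I) v hi,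
          orderedProd_update_of_pos K (fun j => j ∉ I) v hi, MultilinearMap.map_update_smul,
          mul_smul_comm]
    simp only [koszulBracket, key, Finset.smul_sum]
    refine Finset.sum_congr rfl fun I _ => ?_
    rw [mul_smul_comm, smul_comm])

/-- For odd k the coefficients of a degree zero element have the even degrees m(k-1), so the signed
brackets in the BV axiom can be replaced by unsigned ones. -/
theorem koszulBracket_of_even {R : Type*} [Ring R] (Δ : R → R) {n : ℕ} {deg : Fin n → ℤ}
    (hdeg : ∀ i, Even (deg i)) (v : Fin n → R) :
    koszulBracket Δ deg v = koszulBracket Δ (fun _ => 0) v := by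
  rw [koszulBracket, koszulBracket]
  refine Finset.sum_congr rfl fun I _ => ?_
  have h1 : Even (∑ i ∈ I, ∑ j ∈ Iᶜ, if j < i then deg i * deg j else 0) := by
    refine Finset.even_sum _ fun i _ => Finset.even_sum _ fun j _ => ?_
    split_ifs
    · exact (hdeg i).mul_right _
    · exact Even.zero
  have h2 : (∑ i ∈ I, ∑ j ∈ Iᶜ, if j < i then (0 : ℤ) * 0 else 0) = 0 := by simp
  rw [h2, Int.negOnePow_even _ h1, Int.negOnePow_zero]

theorem orderedProd_single {n : ℕ} (p : Fin n → Prop) [DecidablePred p] (m : Fin n → ℤ)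
    (x : Fin n → A) :
    orderedProd p (fun i => (HahnSeries.single (m i) (x i) : LaurentSeries A)) =
      HahnSeries.single (∑ i with p i, m i) (orderedProd p x) := by
  have h : ∑ i with p i, m i =
      (((List.finRange n).filter (fun i => decide (p i))).map m).sum := rfl
  rw [h, orderedProd, orderedProd]
  induction (List.finRange n).filter (fun i => decide (p i)) with
  | nil => simp
  | cons i l ih => simp [ih, HahnSeries.single_mul_single]

theorem laurentExt_single_coeff (f : ℕ → Module.End K A) (s : ℤ) (y : A) (m : ℤ) :
    (laurentExt f (HahnSeries.single s y)).coeff m =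
      if s ≤ m then f (m - s).toNat y else 0 := by
  rw [laurentExt_coeff]
  split_ifs with h
  · rw [finsum_eq_single _ (m - s).toNat]
    · rw [show m - ((m - s).toNat : ℤ) = s by omega, HahnSeries.coeff_single_same]
    · intro n hn
      rw [HahnSeries.coeff_single_of_ne (by omega), map_zero]
  · refine finsum_eq_zero_of_forall_eq_zero fun n => ?_
    rw [HahnSeries.coeff_single_of_ne (by omega), map_zero]

theorem koszulBracket_laurentExt_single_coeff (f : ℕ → Module.End K A) {n : ℕ} (m : Fin n → ℤ)
    (x : Fin n → A) (M : ℤ) :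
    (koszulBracket (laurentExt f) (fun _ => 0)
      (fun i => (HahnSeries.single (m i) (x i) : LaurentSeries A))).coeff M =
      if ∑ i, m i ≤ M then
        koszulBracket (fun y => f (M - ∑ i, m i).toNat y) (fun _ => 0) x else 0 := by
  have hterm : ∀ I : Finset (Fin n),
      (laurentExt f (orderedProd (fun i => i ∈ I)
        (fun i => (HahnSeries.single (m i) (x i) : LaurentSeries A))) *
        orderedProd (fun i => i ∉ I)
        (fun i => (HahnSeries.single (m i) (x i) : LaurentSeries A))).coeff M =
      if ∑ i, m i ≤ M then f (M - ∑ i, m i).toNat (orderedProd (fun i => i ∈ I) x) *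
        orderedProd (fun i => i ∉ I) x else 0 := by
    intro I
    have hs : ∑ i with i ∈ I, m i + ∑ i with i ∉ I, m i = ∑ i, m i :=
      Finset.sum_filter_add_sum_filter_not _ _ _
    rw [orderedProd_single, orderedProd_single, HahnSeries.coeff_mul_single,
      laurentExt_single_coeff, ← hs]
    split_ifs with h1 h2 h2
    · congr 3; omega
    · omega
    · omega
    · rw [zero_mul]
  have hneg : ∀ (e : ℕ) (z : LaurentSeries A),
      ((-1 : LaurentSeries A) ^ e * z).coeff M = (-1 : A) ^ e * z.coeff M := by
    intro e z
    rcases Nat.even_or_odd e with he | he <;> simp [he.neg_one_pow]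
  simp only [koszulBracket, HahnSeries.coeff_sum, mul_zero, ite_self, Finset.sum_const_zero,
    Int.negOnePow_zero, one_smul, hneg, hterm]
  split_ifs <;> simp

theorem truncLT_eq_sum_single {s B : ℤ} {a : LaurentSeries A} (ha : a ∈ orderGE K A s) :
    HahnSeries.truncLT B a = ∑ m ∈ Finset.Ico s B, HahnSeries.single m (a.coeff m) := by
  rw [mem_orderGE] at ha
  ext m
  rw [HahnSeries.coeff_sum, HahnSeries.coeff_truncLT]
  by_cases hm : m ∈ Finset.Ico s B
  · rw [Finset.sum_eq_single_of_mem m hm, HahnSeries.coeff_single_same,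
      if_pos (Finset.mem_Ico.1 hm).2]
    exact fun j _ hj => HahnSeries.coeff_single_of_ne hj.symm
  · have h0 : ∀ j ∈ Finset.Ico s B, (HahnSeries.single j (a.coeff j)).coeff m = 0 :=
      fun j hj => HahnSeries.coeff_single_of_ne fun h => hm (h ▸ hj)
    rw [Finset.sum_eq_zero h0]
    rw [Finset.mem_Ico, not_and] at hm
    split_ifs with h
    · exact ha m (by by_contra h'; exact hm (by omega) h)
    · rfl

/-- A change of order s meets n - 1 other factors, each with at most a simple pole. This permits
truncating a to a Laurent polynomial. -/
theorem koszulBracket_const_sub_mem_orderGE (f : ℕ → Module.End K A) {a a' : LaurentSeries A}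
    (ha : a ∈ orderGE K A (-1)) (ha' : a' ∈ orderGE K A (-1)) {s : ℤ}
    (h : a - a' ∈ orderGE K A s) (n : ℕ) :
    koszulBracket (laurentExt f) (fun _ : Fin n => 0) (fun _ => a) -
      koszulBracket (laurentExt f) (fun _ : Fin n => 0) (fun _ => a') ∈
      orderGE K A (s - n + 1) := by
  rw [koszulBracket_const, koszulBracket_const, ← Finset.sum_sub_distrib]
  refine Submodule.sum_mem _ fun i hi => ?_
  simp only [Finset.mem_range] at hi
  rw [← smul_sub, ← mul_sub]
  refine (orderGE K A _).smul_of_tower_mem _ ?_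
  have e : laurentExt f (a ^ i) * a ^ (n - i) - laurentExt f (a' ^ i) * a' ^ (n - i) =
      laurentLin f (a ^ i - a' ^ i) * a ^ (n - i) +
        laurentLin f (a' ^ i) * (a ^ (n - i) - a' ^ (n - i)) := by
    rw [map_sub, laurentLin_apply, laurentLin_apply]; noncomm_ring
  have hmem : laurentExt f (a ^ i) * a ^ (n - i) - laurentExt f (a' ^ i) * a' ^ (n - i) ∈
      orderGE K A (s - n + 1) := by
    rw [e]
    exact (orderGE K A _).add_mem
      (mul_mem_orderGE (by omega) (laurentLin_mem_orderGE f
        (pow_sub_pow_mem_orderGE ha ha' h i)) (pow_mem_orderGE ha (n - i)))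
      (mul_mem_orderGE (by omega) (laurentLin_mem_orderGE f (pow_mem_orderGE ha' i))
        (pow_sub_pow_mem_orderGE ha ha' h (n - i)))
  rcases Nat.even_or_odd (n - i) with he | he
  · simpa [he.neg_one_pow] using hmem
  · rw [he.neg_one_pow, neg_one_mul]
    exact neg_mem hmem

/-- The n factors contribute a pole of order at most n, and the BV congruence returns a factor
t^{n-1}, so the bracket has at most a simple pole. -/
theorem koszulBracket_const_mem_orderGE {𝒜 : ℤ → Submodule K A} {k : ℤ} (hk : Odd k)
    {Δ : (Module.End K A)⟦X⟧} (hΔ : IsDerivedBV 𝒜 k Δ) {a : LaurentSeries A}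
    (ha : a ∈ orderGE K A (-1)) (hdeg : a ∈ coeffIn fun m => 𝒜 (m * (k - 1))) {n : ℕ}
    (hn : 1 ≤ n) :
    koszulBracket (laurentExt fun j => PowerSeries.coeff j Δ) (fun _ : Fin n => 0)
      (fun _ => a) ∈ orderGE K A (-1) := by
  set f : ℕ → Module.End K A := fun j => PowerSeries.coeff j Δ with hf
  -- Cutting at order n alters the bracket only in orders at least n - n + 1 = 1, and leaves
  -- finitely many monomials for the multilinear expansion.
  have ht : a - HahnSeries.truncLT (n : ℤ) a ∈ orderGE K A n := by
    rw [mem_orderGE]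
    intro m hm
    rw [HahnSeries.coeff_sub, HahnSeries.coeff_truncLT_of_lt hm, sub_self]
  have ht' : HahnSeries.truncLT (n : ℤ) a ∈ orderGE K A (-1) := by
    have h := (orderGE K A (-1)).sub_mem ha (orderGE_anti (by omega) ht)
    rwa [sub_sub_cancel] at h
  have h1 := koszulBracket_const_sub_mem_orderGE f ha ht' ht n
  refine (Submodule.sub_mem_iff_left _ ?_).1 (orderGE_anti (by omega) h1)
  rw [mem_orderGE]
  intro M hM
  rw [truncLT_eq_sum_single ha]
  change ((koszulMultilinear (laurentLin f) n) fun _ =>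
    ∑ m ∈ Finset.Ico (-1 : ℤ) n, HahnSeries.single m (a.coeff m)).coeff M = 0
  rw [MultilinearMap.map_sum_finset, HahnSeries.coeff_sum]
  refine Finset.sum_eq_zero fun r hr => ?_
  change (koszulBracket (laurentExt f) (fun _ => 0)
      (fun i => (HahnSeries.single (r i) (a.coeff (r i)) : LaurentSeries A))).coeff M = 0
  rw [koszulBracket_laurentExt_single_coeff]
  split_ifs with hs
  · have hr' : ∀ i, -1 ≤ r i := fun i => (Finset.mem_Ico.1 (Fintype.mem_piFinset.1 hr i)).1
    have hsum : -(n : ℤ) ≤ ∑ i, r i := by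
      have := Finset.sum_le_sum fun i (_ : i ∈ Finset.univ) => hr' i
      simpa using this
    rw [← koszulBracket_of_even _ (deg := fun i => r i * (k - 1))
      fun i => (hk.sub_odd odd_one).mul_left _]
    -- The exponents sum to at least -n, so M < -1 leaves the index of Δ below n - 1. The same
    -- bounds force n ≥ 2, as the axiom requires.
    refine hΔ.bracket n (by omega) _ _ (fun i => hdeg (r i)) _ (by omega)
  · rfl

end KoszulLaurent

/-! ### Homological perturbation theory in a filtered algebra -/

section Perturbation

/-- Multiplying by 1 - HP on the left and using D² = (D + P)² = 0 removes G from the front. Once 1 +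
HD + DH is read as τσ, this is Δτ̆ = τ̆Δ'. -/
theorem perturbation_left {E : Type*} [Ring E] {D P H G : E} (hD : D * D = 0)
    (hDP : (D + P) * (D + P) = 0) (h₁ : (1 - H * P) * G = 1) (h₂ : G * (1 - H * P) = 1) :
    (D + P) * G = G * (D + (1 + (H * D + D * H)) * P * G) := by
  have key : (1 - H * P) * ((D + P) * G) = D + (1 + (H * D + D * H)) * P * G := by
    linear_combination (norm := noncomm_ring) (-H * hDP * G) + H * hD * G + D * h₁
  rw [← key, ← mul_assoc, h₂, one_mul]

theorem perturbation_right {E : Type*} [Ring E] {D P H G : E} (hD : D * D = 0)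
    (hDP : (D + P) * (D + P) = 0) (h₁ : (1 - P * H) * G = 1) (h₂ : G * (1 - P * H) = 1) :
    G * (D + P) = (D + G * P * (1 + (H * D + D * H))) * G := by
  have key : (G * (D + P)) * (1 - P * H) = D + G * P * (1 + (H * D + D * H)) := by
    linear_combination (norm := noncomm_ring) (-G * hDP * H) + G * hD * H + h₂ * D
  rw [← key, mul_assoc, h₁, mul_one]

/-- Both sides are multiplied by 1 - HP on the left and by 1 - PH on the right. The relation GH =
HG' then eliminates the inverses, and only D² = (D + P)² = 0 is needed. -/
theorem perturbation_homotopy {E : Type*} [Ring E] {D P H G G' : E} (hD : D * D = 0)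
    (hDP : (D + P) * (D + P) = 0) (h₁ : (1 - H * P) * G = 1) (h₂ : G * (1 - H * P) = 1)
    (h₁' : (1 - P * H) * G' = 1) (h₂' : G' * (1 - P * H) = 1) :
    G * H * (D + P) + (D + P) * (G * H) = G * (1 + (H * D + D * H)) * G' - 1 := by
  have hGH : G * H = H * G' := by
    calc G * H = G * H * ((1 - P * H) * G') := by rw [h₁', mul_one]
      _ = G * (1 - H * P) * H * G' := by noncomm_ring
      _ = H * G' := by rw [h₂, one_mul]
  have key : (1 - H * P) * (G * H * (D + P) + (D + P) * (G * H)) * (1 - P * H) =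
      (1 + (H * D + D * H)) - (1 - H * P) * (1 - P * H) := by
    have e : (1 - H * P) * (G * H * (D + P) + (D + P) * (G * H)) * (1 - P * H) =
        H * (D + P) * (1 - P * H) + (1 - H * P) * (D + P) * H := by
      calc _ = ((1 - H * P) * G) * H * (D + P) * (1 - P * H) +
            (1 - H * P) * (D + P) * (G * H) * (1 - P * H) := by noncomm_ring
        _ = _ := by
          rw [h₁, hGH, one_mul]
          congr 1
          rw [mul_assoc, mul_assoc H, h₂', mul_one]
    rw [e]
    linear_combination (norm := noncomm_ring) (-H * hDP * H) + H * hD * H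
  calc G * H * (D + P) + (D + P) * (G * H)
      = (G * (1 - H * P)) * (G * H * (D + P) + (D + P) * (G * H)) * ((1 - P * H) * G') := by
        rw [h₂, h₁', one_mul, mul_one]
    _ = G * ((1 - H * P) * (G * H * (D + P) + (D + P) * (G * H)) * (1 - P * H)) * G' := by
        simp only [mul_assoc]
    _ = G * (1 + (H * D + D * H)) * G' - (G * (1 - H * P)) * ((1 - P * H) * G') := by
        rw [key]; noncomm_ring
    _ = _ := by rw [h₂, h₁', one_mul]

/-- A perturbed contraction of filtered algebras: `P` is the perturbation of the differential `D`
of `V`, `G` and `G'` are the inverses of `1 - HP` and `1 - PH`, and the kernel of `H` is a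
subalgebra on which `S` is multiplicative. -/
structure IsPerturbedContraction {K V W : Type*} [Field K] [Ring V] [Algebra K V] [Ring W]
    [Algebra K W] (I : ℕ → Submodule K V) (J : ℕ → Submodule K W) (D P H G G' : Module.End K V)
    (dW : Module.End K W) (S : V →ₗ[K] W) (T : W →ₗ[K] V) : Prop where
  filtV : IsRingFiltration I
  filtW : IsRingFiltration J
  D_D : D * D = 0
  DP_DP : (D + P) * (D + P) = 0
  inv_G : (1 - H * P) * G = 1
  G_inv : G * (1 - H * P) = 1
  inv_G' : (1 - P * H) * G' = 1
  G'_inv : G' * (1 - P * H) = 1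
  homotopy : H * D + D * H = T ∘ₗ S - 1
  S_H : ∀ x, S (H x) = 0
  H_T : ∀ y, H (T y) = 0
  H_H : ∀ x, H (H x) = 0
  S_T : ∀ y, S (T y) = y
  T_d : ∀ y, T (dW y) = D (T y)
  S_D : ∀ x, S (D x) = dW (S x)
  D_mem : ∀ p x, x ∈ I p → D x ∈ I p
  P_mem : ∀ p x, x ∈ I p → P x ∈ I p
  H_mem : ∀ p x, x ∈ I p → H x ∈ I p
  G_mem : ∀ p x, x ∈ I p → G x ∈ I p
  G'_mem : ∀ p x, x ∈ I p → G' x ∈ I p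
  S_mem : ∀ p x, x ∈ I p → S x ∈ J p
  T_mem : ∀ p x, x ∈ J p → T x ∈ I p
  H_mul : ∀ x y, H x = 0 → H y = 0 → H (x * y) = 0
  S_mul : ∀ x y, H x = 0 → H y = 0 → S (x * y) = S x * S y
  H_one : H 1 = 0
  S_one : S 1 = 1
  D_one : D 1 = 0
  P_one : P 1 = 0

namespace IsPerturbedContraction

variable {K V W : Type*} [Field K] [Ring V] [Algebra K V] [Ring W] [Algebra K W]
  {I : ℕ → Submodule K V} {J : ℕ → Submodule K W} {D P H G G' : Module.End K V}
  {dW : Module.End K W} {S : V →ₗ[K] W} {T : W →ₗ[K] V}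

theorem homotopy_apply (c : IsPerturbedContraction I J D P H G G' dW S T) (x : V) :
    H (D x) + D (H x) = T (S x) - x :=
  LinearMap.congr_fun c.homotopy x

theorem G_sub (c : IsPerturbedContraction I J D P H G G' dW S T) (x : V) :
    G (x - H (P x)) = x :=
  LinearMap.congr_fun c.G_inv x

theorem sub_G (c : IsPerturbedContraction I J D P H G G' dW S T) (x : V) :
    G x - H (P (G x)) = x :=
  LinearMap.congr_fun c.inv_G x

theorem G'_sub (c : IsPerturbedContraction I J D P H G G' dW S T) (x : V) :
    G' (x - P (H x)) = x :=
  LinearMap.congr_fun c.G'_inv x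

/-- On Ker H every term of ∑ (PH)ⁿ except the first vanishes, so σ̆ restricts to σ there. -/
theorem G'_of_ker (c : IsPerturbedContraction I J D P H G G' dW S T) {x : V} (hx : H x = 0) :
    G' x = x := by
  simpa [hx] using c.G'_sub x

/-- G is invertible, hence Ker h̆ = Ker h. -/
theorem G_H_eq_zero_iff (c : IsPerturbedContraction I J D P H G G' dW S T) {x : V} :
    G (H x) = 0 ↔ H x = 0 := by
  refine ⟨fun h => ?_, fun h => by rw [h, map_zero]⟩
  simpa [h] using (c.sub_G (H x)).symm

theorem T_S_of_ker (c : IsPerturbedContraction I J D P H G G' dW S T) {x : V} (hx : H x = 0) :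
    T (S x) = x + H (D x) := by
  have h := c.homotopy_apply x
  rw [hx, map_zero, add_zero] at h
  rw [h]; abel

theorem T_one (c : IsPerturbedContraction I J D P H G G' dW S T) : T 1 = 1 := by
  have h := c.T_S_of_ker c.H_one
  rwa [c.S_one, c.D_one, map_zero, add_zero] at h

theorem G_one (c : IsPerturbedContraction I J D P H G G' dW S T) : G 1 = 1 := by
  simpa [c.P_one] using c.G_sub 1

theorem transferred_one (c : IsPerturbedContraction I J D P H G G' dW S T) :
    (dW + S ∘ₗ P ∘ₗ G ∘ₗ T) 1 = 0 := by
  have h : dW 1 = 0 := by rw [← c.S_one, ← c.S_D, c.D_one, map_zero]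
  simp [h, c.T_one, c.G_one, c.P_one]

theorem transferred_mem (c : IsPerturbedContraction I J D P H G G' dW S T) (p : ℕ) (y : W)
    (hy : y ∈ J p) : (dW + S ∘ₗ P ∘ₗ G ∘ₗ T) y ∈ J p := by
  have h : dW y = S (D (T y)) := by rw [c.S_D, c.S_T]
  have hT := c.T_mem p y hy
  rw [LinearMap.add_apply, h]
  exact (J p).add_mem (c.S_mem p _ (c.D_mem p _ hT))
    (c.S_mem p _ (c.P_mem p _ (c.G_mem p _ hT)))

theorem one_add_homotopy (c : IsPerturbedContraction I J D P H G G' dW S T) :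
    1 + (H * D + D * H) = T ∘ₗ S := by
  rw [c.homotopy]; abel

theorem perturbed_T (c : IsPerturbedContraction I J D P H G G' dW S T) (y : W) :
    (D + P) (G (T y)) = G (T ((dW + S ∘ₗ P ∘ₗ G ∘ₗ T) y)) := by
  have h := LinearMap.congr_fun
    (perturbation_left c.D_D c.DP_DP c.inv_G c.G_inv) (T y)
  rw [c.one_add_homotopy] at h
  change (D + P) (G (T y)) = G (D (T y) + T (S (P (G (T y))))) at h
  rw [h, LinearMap.add_apply, map_add T, c.T_d]
  rfl

theorem perturbed_S (c : IsPerturbedContraction I J D P H G G' dW S T) (x : V) :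
    S (G' ((D + P) x)) = (dW + S ∘ₗ P ∘ₗ G ∘ₗ T) (S (G' x)) := by
  have h := LinearMap.congr_fun
    (perturbation_right c.D_D c.DP_DP c.inv_G' c.G'_inv) x
  rw [c.one_add_homotopy] at h
  change G' ((D + P) x) = D (G' x) + G' (P (T (S (G' x)))) at h
  -- Intertwining the two geometric series lets Δ' be written with P G as well as with G' P.
  have hPG : P * G = G' * P := by
    calc P * G = G' * (1 - P * H) * P * G := by rw [c.G'_inv, one_mul]
      _ = G' * P * ((1 - H * P) * G) := by
        simp only [mul_sub, sub_mul, mul_one, one_mul, mul_assoc]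
      _ = G' * P := by rw [c.inv_G, mul_one]
  have hPG' : ∀ z, P (G z) = G' (P z) := LinearMap.congr_fun hPG
  rw [h, map_add, c.S_D, LinearMap.add_apply]
  simp [hPG']

theorem perturbed_homotopy (c : IsPerturbedContraction I J D P H G G' dW S T) (x : V) :
    G (H ((D + P) x)) + (D + P) (G (H x)) = G (T (S (G' x))) - x := by
  have h := LinearMap.congr_fun
    (perturbation_homotopy c.D_D c.DP_DP c.inv_G c.G_inv c.inv_G' c.G'_inv) x
  rw [c.one_add_homotopy] at h
  exact h

theorem H_pow (c : IsPerturbedContraction I J D P H G G' dW S T) {a : V} (ha : H a = 0) (n : ℕ) :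
    H (a ^ n) = 0 := by
  induction n with
  | zero => rw [pow_zero, c.H_one]
  | succ n ih => rw [pow_succ]; exact c.H_mul _ _ ih ha

theorem S_pow (c : IsPerturbedContraction I J D P H G G' dW S T) {a : V} (ha : H a = 0) (n : ℕ) :
    S (a ^ n) = S a ^ n := by
  induction n with
  | zero => rw [pow_zero, pow_zero, c.S_one]
  | succ n ih => rw [pow_succ, pow_succ, c.S_mul _ _ (c.H_pow ha n) ha, ih]

theorem H_expSum (c : IsPerturbedContraction I J D P H G G' dW S T) {a : V} (ha : H a = 0)
    (N : ℕ) : H (expSum K N a) = 0 := by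
  simp [expSum, c.H_pow ha]

theorem S_expSum (c : IsPerturbedContraction I J D P H G G' dW S T) {a : V} (ha : H a = 0)
    (N : ℕ) : S (expSum K N a) = expSum K N (S a) := by
  simp [expSum, c.S_pow ha]

theorem DP_mem (c : IsPerturbedContraction I J D P H G G' dW S T) (p : ℕ) (x : V)
    (hx : x ∈ I p) : (D + P) x ∈ I p :=
  (I p).add_mem (c.D_mem p x hx) (c.P_mem p x hx)

theorem DP_one (c : IsPerturbedContraction I J D P H G G' dW S T) : (D + P) 1 = 0 := by
  rw [LinearMap.add_apply, c.D_one, c.P_one, add_zero]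

/-- If `H y` lies in `Iᵖ`, then so does `H (y z)` for `z` in the kernel of `H`. -/
theorem H_mul_mem (c : IsPerturbedContraction I J D P H G G' dW S T) {p : ℕ} {y z : V}
    (hy : H y ∈ I p) (hz : H z = 0) : H (y * z) ∈ I p := by
  have h := c.homotopy_apply y
  -- The homotopy splits y into a part in Ker H and -D(Hy). The first contributes nothing after
  -- multiplication by z because Ker H is a subalgebra, and the second is small by assumption.
  have e : y = (T (S y) - H (D y)) - D (H y) := by
    rw [sub_sub, h]; abel
  have hk : H (T (S y) - H (D y)) = 0 := by rw [map_sub, c.H_T, c.H_H, sub_zero]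
  rw [e, sub_mul, map_sub, c.H_mul _ _ hk hz, zero_sub]
  exact neg_mem (c.H_mem p _ (c.filtV.mul_right _ (c.D_mem p _ hy)))

/-- σ̆Δ = Δ'σ̆ is applied to e^a, where σ̆(e^a) = e^{σa} because e^a lies in Ker H. -/
theorem mc_S [CharZero K] (c : IsPerturbedContraction I J D P H G G' dW S T) {a : V}
    (ha : H a = 0) (ha₁ : a ∈ I 1) {N : ℕ} (h : mcSum (D + P) N a ∈ I (N + 1)) :
    mcSum (dW + S ∘ₗ P ∘ₗ G ∘ₗ T) N (S a) ∈ J (N + 1) := by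
  rw [mcSum_mem_iff c.filtV c.DP_mem c.DP_one ha₁] at h
  rw [mcSum_mem_iff c.filtW c.transferred_mem c.transferred_one (c.S_mem 1 a ha₁)]
  have e := c.perturbed_S (expSum K N a)
  rw [c.G'_of_ker (c.H_expSum ha N), c.S_expSum ha N] at e
  rw [← e]
  exact c.S_mem _ _ (c.G'_mem _ _ h)

/-- At e^a the perturbed homotopy reduces to h̆Δ(e^a) = τ̆(e^{σa}) - e^a. Since Δ(e^a) is mc(a) e^a
up to small terms and e^a lies in Ker H, smallness of H(mc(a)) alone suffices. -/
theorem expSum_sub_mem [CharZero K] (c : IsPerturbedContraction I J D P H G G' dW S T) {a : V}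
    (ha : H a = 0) (ha₁ : a ∈ I 1) {N : ℕ} (h : H (mcSum (D + P) N a) ∈ I (N + 1)) :
    G (T (expSum K N (S a))) - expSum K N a ∈ I (N + 1) := by
  have e := c.perturbed_homotopy (expSum K N a)
  rw [c.G'_of_ker (c.H_expSum ha N), c.S_expSum ha N, c.H_expSum ha N, map_zero, map_zero,
    add_zero] at e
  rw [← e]
  refine c.G_mem _ _ ?_
  have h1 := (I _).add_mem (c.H_mem _ _ (apply_expSum_sub_mem c.filtV c.DP_mem c.DP_one ha₁ N))
    (c.H_mul_mem h (c.H_expSum ha N))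
  rwa [map_sub, sub_add_cancel] at h1

/-- Once e^a ≡ τ̆(e^{σa}), the relation Δτ̆ = τ̆Δ' carries the transferred equation back to a. -/
theorem mc_of_mc_S [CharZero K] (c : IsPerturbedContraction I J D P H G G' dW S T) {a : V}
    (ha : H a = 0) (ha₁ : a ∈ I 1) {N : ℕ} (h : H (mcSum (D + P) N a) ∈ I (N + 1))
    (hb : mcSum (dW + S ∘ₗ P ∘ₗ G ∘ₗ T) N (S a) ∈ J (N + 1)) :
    mcSum (D + P) N a ∈ I (N + 1) := by
  rw [mcSum_mem_iff c.filtW c.transferred_mem c.transferred_one (c.S_mem 1 a ha₁)] at hb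
  rw [mcSum_mem_iff c.filtV c.DP_mem c.DP_one ha₁]
  have h1 := c.DP_mem _ _ (c.expSum_sub_mem ha ha₁ h)
  rw [map_sub, c.perturbed_T] at h1
  have h2 := (I _).sub_mem (c.G_mem _ _ (c.T_mem _ _ hb)) h1
  rwa [sub_sub_cancel] at h2

theorem H_G_H (c : IsPerturbedContraction I J D P H G G' dW S T) (x : V) : H (G (H x)) = 0 := by
  have h := c.sub_G (H x)
  rw [sub_eq_iff_eq_add] at h
  rw [h, map_add, c.H_H, c.H_H, add_zero]

theorem S_G_H (c : IsPerturbedContraction I J D P H G G' dW S T) (x : V) : S (G (H x)) = 0 := by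
  have h := c.sub_G (H x)
  rw [sub_eq_iff_eq_add] at h
  rw [h, map_add, c.S_H, c.S_H, add_zero]

/-- The Newton iteration for the equation `H (∑ K(D + P)ₙ(a, …, a)/n!) = 0` gains one step in the
filtration. -/
theorem newton_step (c : IsPerturbedContraction I J D P H G G' dW S T) {a : V} (ha₁ : a ∈ I 1)
    {p : ℕ} (h : H (mcSum (D + P) p a) ∈ I (p + 1)) :
    G (H (mcSum (D + P) (p + 1) a)) ∈ I (p + 1) ∧
      H (mcSum (D + P) (p + 1) (a + G (H (mcSum (D + P) (p + 1) a)))) ∈ I (p + 2) := by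
  set x := G (H (mcSum (D + P) (p + 1) a)) with hx
  have h1 : H (mcSum (D + P) (p + 1) a) ∈ I (p + 1) := by
    have h2 := c.H_mem _ _ (mcSum_sub_mcSum_mem c.filtV c.DP_mem ha₁ (Nat.le_succ p))
    have h3 := (I _).add_mem h2 h
    rwa [map_sub, sub_add_cancel] at h3
  have hxI : x ∈ I (p + 1) := c.G_mem _ _ h1
  refine ⟨hxI, ?_⟩
  have h4 := c.H_mem _ _ (mcSum_add_sub_mem c.filtV c.DP_mem c.DP_one ha₁ (by omega) hxI
    (N := p + 1) (by omega))
  -- The correction x = h̆(mc(a)) lies in Ker H and Ker S, so the homotopy identity gives H D x =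
  -- -x, while x - H P x = H(mc(a)). The linearised equation is thus solved exactly, and only terms
  -- of higher filtration remain.
  have e : H ((D + P) x) = - H (mcSum (D + P) (p + 1) a) := by
    have e1 := c.homotopy_apply x
    have e2 := c.sub_G (H (mcSum (D + P) (p + 1) a))
    have hHx : H x = 0 := c.H_G_H _
    have hSx : S x = 0 := c.S_G_H _
    rw [← hx] at e2
    rw [hHx, hSx, map_zero, map_zero, add_zero, zero_sub] at e1
    rw [LinearMap.add_apply, map_add, e1, ← e2]
    abel
  rwa [map_sub, map_sub, e, sub_neg_eq_add, sub_add_cancel] at h4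

end IsPerturbedContraction

end Perturbation

/-! ### Operators on Laurent series given by power series -/

section SeriesMaps

variable {K A : Type*} [Field K] [AddCommGroup A] [Module K A]

/-- The extension of `p` to Laurent series maps series with coefficients in `S` to series with
coefficients in `S'`, term by term. -/
def SeriesMaps (p : (Module.End K A)⟦X⟧) (S S' : ℤ → Submodule K A) : Prop :=
  ∀ (n : ℕ) (m : ℤ) (x : A), x ∈ S (m - n) → PowerSeries.coeff n p x ∈ S' m

theorem SeriesMaps.laurentHom_mem {p : (Module.End K A)⟦X⟧} {S S' : ℤ → Submodule K A}
    (hp : SeriesMaps p S S') {x : LaurentSeries A} (hx : x ∈ coeffIn S) :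
    laurentHom K A p x ∈ coeffIn S' :=
  laurentLin_mem_coeffIn hp hx

theorem SeriesMaps.mul {p q : (Module.End K A)⟦X⟧} {S S' S'' : ℤ → Submodule K A}
    (hp : SeriesMaps p S' S'') (hq : SeriesMaps q S S') : SeriesMaps (p * q) S S'' := by
  intro n m x hx
  rw [PowerSeries.coeff_mul, LinearMap.sum_apply]
  refine Submodule.sum_mem _ fun ij hij => hp _ _ _ (hq _ _ _ ?_)
  rw [Finset.HasAntidiagonal.mem_antidiagonal] at hij
  rwa [sub_sub, ← Nat.cast_add, hij]

theorem SeriesMaps.C {g : Module.End K A} {S S' : ℤ → Submodule K A}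
    (hg : ∀ m x, x ∈ S m → g x ∈ S' m) : SeriesMaps (PowerSeries.C g) S S' := by
  intro n m x hx
  rw [PowerSeries.coeff_C]
  split_ifs with h
  · exact hg m x (by simpa [h] using hx)
  · exact zero_mem _

theorem SeriesMaps.pow {p : (Module.End K A)⟦X⟧} {S : ℤ → Submodule K A}
    (hp : SeriesMaps p S S) (n : ℕ) : SeriesMaps (p ^ n) S S := by
  induction n with
  | zero =>
    rw [pow_zero, ← map_one PowerSeries.C]
    exact SeriesMaps.C fun m x hx => hx
  | succ n ih => rw [pow_succ]; exact ih.mul hp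

theorem SeriesMaps.geomSeries {p : (Module.End K A)⟦X⟧} {S : ℤ → Submodule K A}
    (hp : SeriesMaps p S S) : SeriesMaps (geomSeries p) S S := by
  intro n m x hx
  rw [DerivedBV.geomSeries, PowerSeries.coeff_mk, LinearMap.sum_apply]
  exact Submodule.sum_mem _ fun i _ => hp.pow i n m x hx

theorem coeff_plusPart (Δ : (Module.End K A)⟦X⟧) (n : ℕ) :
    PowerSeries.coeff n (plusPart Δ) = if n = 0 then 0 else PowerSeries.coeff n Δ := by
  rw [plusPart, map_sub, PowerSeries.coeff_C]
  split_ifs with h <;> simp [h]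

theorem SeriesMaps.plusPart {Δ : (Module.End K A)⟦X⟧} {S S' : ℤ → Submodule K A}
    (hΔ : SeriesMaps Δ S S') : SeriesMaps (plusPart Δ) S S' := by
  intro n m x hx
  rw [coeff_plusPart]
  split_ifs
  · exact zero_mem _
  · exact hΔ n m x hx

theorem constantCoeff_plusPart (Δ : (Module.End K A)⟦X⟧) :
    PowerSeries.constantCoeff (plusPart Δ) = 0 := by
  rw [← PowerSeries.coeff_zero_eq_constantCoeff_apply, coeff_plusPart, if_pos rfl]

theorem coeff_geomSeries_sub {p : (Module.End K A)⟦X⟧} (hp : PowerSeries.constantCoeff p = 0)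
    {j m : ℕ} (hj : j ≤ m) :
    PowerSeries.coeff j (geomSeries p - ∑ n ∈ Finset.range (m + 1), p ^ n) = 0 := by
  rw [map_sub, map_sum, geomSeries, PowerSeries.coeff_mk,
    Finset.sum_subset (Finset.range_mono (Nat.succ_le_succ hj)), sub_self]
  intro i _ hi
  exact coeff_pow_eq_zero_of_lt hp (by simpa using hi)

/-- Up to degree m the series agrees with the finite geometric sum, whose defect p^{m+1} is
invisible in that degree. -/
theorem one_sub_mul_geomSeries {p : (Module.End K A)⟦X⟧}
    (hp : PowerSeries.constantCoeff p = 0) : (1 - p) * geomSeries p = 1 := by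
  ext1 m
  have h1 : PowerSeries.coeff m
      ((1 - p) * (geomSeries p - ∑ n ∈ Finset.range (m + 1), p ^ n)) = 0 := by
    rw [PowerSeries.coeff_mul]
    refine Finset.sum_eq_zero fun ij hij => ?_
    rw [Finset.HasAntidiagonal.mem_antidiagonal] at hij
    rw [coeff_geomSeries_sub hp (by omega), mul_zero]
  rw [mul_sub, mul_neg_geom_sum, map_sub, sub_eq_zero] at h1
  rw [h1, map_sub, coeff_pow_eq_zero_of_lt hp (Nat.lt_succ_self m), sub_zero]

theorem geomSeries_mul_one_sub {p : (Module.End K A)⟦X⟧}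
    (hp : PowerSeries.constantCoeff p = 0) : geomSeries p * (1 - p) = 1 := by
  ext1 m
  have h1 : PowerSeries.coeff m
      ((geomSeries p - ∑ n ∈ Finset.range (m + 1), p ^ n) * (1 - p)) = 0 := by
    rw [PowerSeries.coeff_mul]
    refine Finset.sum_eq_zero fun ij hij => ?_
    rw [Finset.HasAntidiagonal.mem_antidiagonal] at hij
    rw [coeff_geomSeries_sub hp (by omega), zero_mul]
  rw [sub_mul, geom_sum_mul_neg, map_sub, sub_eq_zero] at h1
  rw [h1, map_sub, coeff_pow_eq_zero_of_lt hp (Nat.lt_succ_self m), sub_zero]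

theorem laurentHom_eq_add (Δ : (Module.End K A)⟦X⟧) :
    laurentHom K A Δ =
      coeffLin (PowerSeries.coeff 0 Δ) + laurentHom K A (plusPart Δ) := by
  rw [← laurentHom_C, ← map_add, plusPart, add_sub_cancel]

variable {B : Type*} [AddCommGroup B] [Module K B]

theorem laurentLin_perturbedσ (Δ : (Module.End K A)⟦X⟧) (σ : A →ₗ[K] B) (h : Module.End K A) :
    laurentLin (perturbedσ Δ σ h) =
      coeffLin σ ∘ₗ laurentHom K A (geomSeries (plusPart Δ * PowerSeries.C h)) :=
  laurentLin_comp_left _ _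

theorem laurentLin_perturbedτ (Δ : (Module.End K A)⟦X⟧) (τ : B →ₗ[K] A) (h : Module.End K A) :
    laurentLin (perturbedτ Δ τ h) =
      laurentHom K A (geomSeries (PowerSeries.C h * plusPart Δ)) ∘ₗ coeffLin τ :=
  laurentLin_comp_right _ _

theorem laurentLin_perturbedh (Δ : (Module.End K A)⟦X⟧) (h : Module.End K A) :
    laurentLin (perturbedh Δ h) =
      laurentHom K A (geomSeries (PowerSeries.C h * plusPart Δ)) * coeffLin h := by
  rw [← laurentHom_C, ← map_mul]
  rfl

theorem laurentLin_transferredΔ (Δ : (Module.End K A)⟦X⟧) (dB : Module.End K B) (σ : A →ₗ[K] B)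
    (τ : B →ₗ[K] A) (h : Module.End K A) :
    laurentLin (transferredΔ Δ dB σ τ h) = coeffLin dB + coeffLin σ ∘ₗ
      laurentHom K A (plusPart Δ) ∘ₗ
        laurentHom K A (geomSeries (PowerSeries.C h * plusPart Δ)) ∘ₗ coeffLin τ := by
  have e : laurentLin (fun m => σ ∘ₗ
      (PowerSeries.coeff m (plusPart Δ * geomSeries (PowerSeries.C h * plusPart Δ))) ∘ₗ τ) =
      coeffLin σ ∘ₗ laurentHom K A (plusPart Δ) ∘ₗ
        laurentHom K A (geomSeries (PowerSeries.C h * plusPart Δ)) ∘ₗ coeffLin τ := by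
    rw [laurentLin_comp_left, laurentLin_comp_right, ← laurentHom_apply, map_mul]
    rfl
  rw [← e, ← laurentLin_ite_zero dB, ← laurentLin_add]
  rfl

end SeriesMaps

/-! ### Semifull contractions -/

section Semifull

variable {K A B : Type*} [Field K] [Ring A] [Algebra K A] [Ring B] [Algebra K B]
  {𝒜 : ℤ → Submodule K A} {ℬ : ℤ → Submodule K B}

variable {dA : Module.End K A} {dB : Module.End K B} {σ : A →ₗ[K] B} {τ : B →ₗ[K] A}
  {h : Module.End K A}

/-- This exhibits Ker h as Im τ + Im h, the two kinds of factors to which the semifull axioms apply.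
-/
theorem IsSemifullDGContraction.decompose_ker (hc : IsSemifullDGContraction 𝒜 ℬ dA dB σ τ h)
    {x : A} (hx : h x = 0) : x = τ (σ x) + h (-dA x) := by
  have e := LinearMap.congr_fun hc.contraction.homotopy x
  simp only [LinearMap.add_apply, LinearMap.comp_apply, LinearMap.sub_apply, LinearMap.id_apply,
    hx, map_zero, add_zero] at e
  rw [map_neg, e]
  abel

variable [GradedAlgebra 𝒜] [GradedAlgebra ℬ]

/-- The axioms mention only products h(a)τ(x). Homogeneous decomposition and graded commutativity
supply the other order. -/
theorem map_mul_comm_eq_zero {M : Type*} [AddCommGroup M] [Module K M]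
    (hA : GradedCommutative 𝒜) {h : Module.End K A} {τ : B →ₗ[K] A}
    (hh : HasDegree 𝒜 𝒜 (-1) h) (hτ : HasDegree ℬ 𝒜 0 τ) {φ : A →ₗ[K] M}
    (hφ : ∀ (a : A) (x : B), φ (h a * τ x) = 0) (x : B) (a : A) : φ (τ x * h a) = 0 := by
  induction x using DirectSum.Decomposition.inductionOn ℬ with
  | zero => simp
  | add x y hx hy => rw [map_add, add_mul, map_add, hx, hy, add_zero]
  | @homogeneous i x =>
    induction a using DirectSum.Decomposition.inductionOn 𝒜 with
    | zero => simp
    | add a b ha hb => rw [map_add, mul_add, map_add, ha, hb, add_zero]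
    | @homogeneous j a =>
      rw [hA _ _ _ _ (hτ i x x.2) (hh j a a.2), Units.smul_def, map_zsmul, hφ, smul_zero]

theorem IsSemifullDGContraction.h_mul (hA : GradedCommutative 𝒜)
    (hc : IsSemifullDGContraction 𝒜 ℬ dA dB σ τ h) {x y : A} (hx : h x = 0) (hy : h y = 0) :
    h (x * y) = 0 := by
  rw [hc.decompose_ker hx, hc.decompose_ker hy, add_mul, mul_add, mul_add, map_add, map_add,
    map_add, hc.h_ττ, hc.h_hτ, hc.h_hh,
    map_mul_comm_eq_zero hA hc.contraction.degree_h hc.contraction.degree_τ hc.h_hτ]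
  simp

theorem IsSemifullDGContraction.σ_mul (hA : GradedCommutative 𝒜)
    (hc : IsSemifullDGContraction 𝒜 ℬ dA dB σ τ h) {x y : A} (hx : h x = 0) (hy : h y = 0) :
    σ (x * y) = σ x * σ y := by
  conv_lhs => rw [hc.decompose_ker hx, hc.decompose_ker hy]
  rw [add_mul, mul_add, mul_add, map_add, map_add,
    map_add, hc.σ_ττ, hc.σ_hτ, hc.σ_hh,
    map_mul_comm_eq_zero hA hc.contraction.degree_h hc.contraction.degree_τ hc.σ_hτ]
  simp

theorem coeffLin_mul_eq_zero {h : Module.End K A}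
    (hm : ∀ x y, h x = 0 → h y = 0 → h (x * y) = 0) {x y : LaurentSeries A}
    (hx : coeffLin h x = 0) (hy : coeffLin h y = 0) : coeffLin h (x * y) = 0 := by
  ext m
  rw [coeffLin_coeff, HahnSeries.coeff_mul, map_sum, HahnSeries.coeff_zero]
  refine Finset.sum_eq_zero fun ij _ => hm _ _ ?_ ?_
  · simpa using congrArg (fun z => HahnSeries.coeff z ij.1) hx
  · simpa using congrArg (fun z => HahnSeries.coeff z ij.2) hy

theorem coeffLin_mul_eq_mul {h : Module.End K A} {σ : A →ₗ[K] B}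
    (hm : ∀ x y, h x = 0 → h y = 0 → σ (x * y) = σ x * σ y) {x y : LaurentSeries A}
    (hx : coeffLin h x = 0) (hy : coeffLin h y = 0) :
    coeffLin σ (x * y) = coeffLin σ x * coeffLin σ y := by
  ext m
  rw [coeffLin_coeff, HahnSeries.coeff_mul, map_sum, HahnSeries.coeff_mul]
  have e : ∀ ij : ℤ × ℤ, σ (x.coeff ij.1 * y.coeff ij.2) =
      (coeffLin σ x).coeff ij.1 * (coeffLin σ y).coeff ij.2 := by
    intro ij
    refine hm _ _ ?_ ?_
    · simpa using congrArg (fun z => HahnSeries.coeff z ij.1) hx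
    · simpa using congrArg (fun z => HahnSeries.coeff z ij.2) hy
  rw [Finset.sum_congr rfl fun ij _ => e ij]
  symm
  -- The two index sets differ because σ may kill coefficients; the extra pairs contribute zero.
  refine Finset.sum_subset (fun ij hij => ?_) fun ij hij hij' => ?_
  · rw [Finset.mem_antidiagonal] at hij ⊢
    refine ⟨fun h0 => hij.1 ?_, fun h0 => hij.2.1 ?_, hij.2.2⟩
    · change σ _ = 0
      rw [h0, map_zero]
    · change σ _ = 0
      rw [h0, map_zero]
  · by_contra hne
    refine hij' ?_
    rw [Finset.mem_antidiagonal] at hij ⊢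
    exact ⟨left_ne_zero_of_mul hne, right_ne_zero_of_mul hne, hij.2.2⟩

theorem coeffLin_one_eq_zero {M : Type*} [AddCommGroup M] [Module K M] {g : A →ₗ[K] M}
    (hg : g 1 = 0) : coeffLin g (1 : LaurentSeries A) = 0 := by
  ext m
  rw [coeffLin_coeff, HahnSeries.coeff_one, HahnSeries.coeff_zero]
  split_ifs <;> simp [hg]

theorem isRingFiltration_coeffIn {F : ℕ → Submodule K A} (hF : IsRingFiltration F) :
    IsRingFiltration (R := LaurentSeries A) fun p => coeffIn fun _ => F p where
  zero := by
    rw [eq_top_iff]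
    intro x _ m
    rw [hF.zero]
    exact Submodule.mem_top
  anti p q hpq x hx m := hF.anti hpq (hx m)
  mul p q x y hx hy := mul_mem_coeffIn (fun _ _ x y hx hy => hF.mul p q x y hx hy) hx hy

/-- Multiplicativity holds although τ need not be multiplicative, because τ(xy) = τσ(τx τy) and τσ
is continuous. -/
theorem isRingFiltration_induced {F : ℕ → Submodule K A} (hF : IsRingFiltration F)
    (hτσ : RespectsFiltration F F (τ ∘ₗ σ)) (hσ : ∀ x y : B, σ (τ x * τ y) = x * y) :
    IsRingFiltration (inducedFiltration F τ) where
  zero := by rw [inducedFiltration, hF.zero, Submodule.comap_top]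
  anti p q hpq := Submodule.comap_mono (hF.anti hpq)
  mul p q x y hx hy := by
    have h1 := hτσ (p + q) _ (hF.mul p q _ _ hx hy)
    rwa [LinearMap.comp_apply, hσ] at h1

theorem IsCompleteFiltration.isRingFiltration {F : ℕ → Submodule K A}
    (hF : IsCompleteFiltration 𝒜 F) : IsRingFiltration F :=
  ⟨hF.zero, hF.anti, hF.mul⟩

theorem isPerturbedContraction (hA : GradedCommutative 𝒜) {k : ℤ} {F : ℕ → Submodule K A}
    {Δ : (Module.End K A)⟦X⟧} (hΔ : IsCompleteDerivedBV 𝒜 k F Δ)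
    (hc : IsSemifullDGContraction 𝒜 ℬ (PowerSeries.coeff 0 Δ) dB σ τ h)
    (hh : RespectsFiltration F F h) (hτσ : RespectsFiltration F F (τ ∘ₗ σ)) :
    IsPerturbedContraction (V := LaurentSeries A) (W := LaurentSeries B)
      (fun p => coeffIn fun _ => F p) (fun p => coeffIn fun _ => inducedFiltration F τ p)
      (coeffLin (PowerSeries.coeff 0 Δ)) (laurentHom K A (plusPart Δ)) (coeffLin h)
      (laurentHom K A (geomSeries (PowerSeries.C h * plusPart Δ)))
      (laurentHom K A (geomSeries (plusPart Δ * PowerSeries.C h)))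
      (coeffLin dB) (coeffLin σ) (coeffLin τ) := by
  have hF := hΔ.filtration.isRingFiltration
  have hcon := hc.contraction
  have hΔm : ∀ p, SeriesMaps Δ (fun _ => F p) (fun _ => F p) :=
    fun p n _ x hx => hΔ.compatible n p x hx
  have hhm : ∀ p, SeriesMaps (PowerSeries.C h) (fun _ => F p) (fun _ => F p) :=
    fun p => SeriesMaps.C fun _ x hx => hh p x hx
  have hHP : PowerSeries.constantCoeff (PowerSeries.C h * plusPart Δ) = 0 := by
    rw [map_mul, constantCoeff_plusPart, mul_zero]
  have hPH : PowerSeries.constantCoeff (plusPart Δ * PowerSeries.C h) = 0 := by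
    rw [map_mul, constantCoeff_plusPart, zero_mul]
  refine
    { filtV := isRingFiltration_coeffIn hF
      filtW := isRingFiltration_coeffIn (isRingFiltration_induced hF hτσ hc.σ_ττ)
      D_D := ?_
      DP_DP := ?_
      inv_G := ?_
      G_inv := ?_
      inv_G' := ?_
      G'_inv := ?_
      homotopy := ?_
      S_H := ?_
      H_T := ?_
      H_H := ?_
      S_T := ?_
      T_d := ?_
      S_D := ?_
      D_mem := fun p x hx => coeffLin_mem_coeffIn (fun _ x hx => hΔ.compatible 0 p x hx) hx
      P_mem := fun p x hx => (hΔm p).plusPart.laurentHom_mem hx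
      H_mem := fun p x hx => coeffLin_mem_coeffIn (fun _ x hx => hh p x hx) hx
      G_mem := fun p x hx => ((hhm p).mul (hΔm p).plusPart).geomSeries.laurentHom_mem hx
      G'_mem := fun p x hx => ((hΔm p).plusPart.mul (hhm p)).geomSeries.laurentHom_mem hx
      -- For the induced filtration, continuity of σ unfolds to continuity of τσ.
      S_mem := fun p x hx => coeffLin_mem_coeffIn (fun _ x hx => hτσ p x hx) hx
      T_mem := fun p x hx => coeffLin_mem_coeffIn (fun _ x hx => hx) hx
      H_mul := fun x y => coeffLin_mul_eq_zero fun x y => hc.h_mul hA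
      S_mul := fun x y => coeffLin_mul_eq_mul fun x y => hc.σ_mul hA
      H_one := coeffLin_one_eq_zero hc.h_one
      S_one := ?_
      D_one := coeffLin_one_eq_zero (hΔ.bv.map_one 0)
      P_one := ?_ }
  · ext x m; exact LinearMap.congr_fun hc.dgA.sq_zero (x.coeff m)
  · rw [← laurentHom_eq_add, ← map_mul, hΔ.bv.sq_zero, map_zero]
  · rw [← laurentHom_C, ← map_mul, ← map_one (laurentHom K A), ← map_sub, ← map_mul,
      one_sub_mul_geomSeries hHP]
  · rw [← laurentHom_C, ← map_mul, ← map_one (laurentHom K A), ← map_sub, ← map_mul,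
      geomSeries_mul_one_sub hHP]
  · rw [← laurentHom_C, ← map_mul, ← map_one (laurentHom K A), ← map_sub, ← map_mul,
      one_sub_mul_geomSeries hPH]
  · rw [← laurentHom_C, ← map_mul, ← map_one (laurentHom K A), ← map_sub, ← map_mul,
      geomSeries_mul_one_sub hPH]
  · ext x m; exact LinearMap.congr_fun hcon.homotopy (x.coeff m)
  · intro x; ext m; exact LinearMap.congr_fun hcon.σ_h (x.coeff m)
  · intro x; ext m; exact LinearMap.congr_fun hcon.h_τ (x.coeff m)
  · intro x; ext m; exact LinearMap.congr_fun hcon.h_h (x.coeff m)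
  · intro x; ext m; exact LinearMap.congr_fun hcon.σ_τ (x.coeff m)
  · intro x; ext m; exact LinearMap.congr_fun hcon.chain_τ (x.coeff m)
  · intro x; ext m; exact LinearMap.congr_fun hcon.chain_σ (x.coeff m)
  · ext m
    rw [coeffLin_coeff, HahnSeries.coeff_one, HahnSeries.coeff_one]
    split_ifs <;> simp [hc.σ_one]
  · ext m
    rw [laurentHom_apply, laurentLin_apply, laurentExt_coeff, HahnSeries.coeff_zero]
    refine finsum_eq_zero_of_forall_eq_zero fun n => ?_
    rw [HahnSeries.coeff_one, coeff_plusPart]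
    split_ifs <;> simp [hΔ.bv.map_one]

end Semifull

/-! ### Maurer-Cartan elements -/

section MaurerCartan

variable {K A : Type*} [Field K] [Ring A] [Algebra K A] {𝒜 : ℤ → Submodule K A}

/-- The degree `d` part of `A((t))`, where `t` has degree `1 - k`. -/
def degIn (𝒜 : ℤ → Submodule K A) (k d : ℤ) : Submodule K (LaurentSeries A) :=
  coeffIn fun m => 𝒜 (m * (k - 1) + d)

theorem mem_degIn_zero {k : ℤ} {x : LaurentSeries A} :
    x ∈ degIn 𝒜 k 0 ↔ ∀ m, x.coeff m ∈ 𝒜 (m * (k - 1)) := by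
  simp only [degIn, mem_coeffIn, add_zero]

theorem HasDegree.seriesMaps {p : (Module.End K A)⟦X⟧} {k d : ℤ}
    (hp : ∀ n : ℕ, HasDegree 𝒜 𝒜 (d + n * (k - 1)) (PowerSeries.coeff n p)) (e : ℤ) :
    SeriesMaps p (fun m => 𝒜 (m * (k - 1) + e)) (fun m => 𝒜 (m * (k - 1) + (e + d))) := by
  intro n m x hx
  have := hp n _ x hx
  rwa [show (m - n) * (k - 1) + e + (d + n * (k - 1)) = m * (k - 1) + (e + d) by ring] at this

theorem HasDegree.coeffLin_mem {B : Type*} [Ring B] [Algebra K B] {ℬ : ℤ → Submodule K B}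
    {g : A →ₗ[K] B} {d : ℤ} (hg : HasDegree 𝒜 ℬ d g) {k e : ℤ} {x : LaurentSeries A}
    (hx : x ∈ degIn 𝒜 k e) : coeffLin g x ∈ degIn ℬ k (e + d) :=
  coeffLin_mem_coeffIn (fun m x hx => by rw [← add_assoc]; exact hg _ x hx) hx

theorem mul_mem_degIn [GradedAlgebra 𝒜] {k d e : ℤ} {x y : LaurentSeries A}
    (hx : x ∈ degIn 𝒜 k d) (hy : y ∈ degIn 𝒜 k e) : x * y ∈ degIn 𝒜 k (d + e) := by
  refine mul_mem_coeffIn (fun m m' x y hx hy => ?_) hx hy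
  have := SetLike.mul_mem_graded hx hy
  rwa [show m * (k - 1) + d + (m' * (k - 1) + e) = (m + m') * (k - 1) + (d + e) by ring] at this

theorem pow_mem_degIn [GradedAlgebra 𝒜] {k : ℤ} {x : LaurentSeries A}
    (hx : x ∈ degIn 𝒜 k 0) (n : ℕ) : x ^ n ∈ degIn 𝒜 k 0 := by
  induction n with
  | zero =>
    intro m
    rw [pow_zero, HahnSeries.coeff_one]
    split_ifs with h
    · simpa [h] using SetLike.GradedOne.one_mem (A := 𝒜)
    · exact zero_mem _
  | succ n ih => rw [pow_succ]; simpa using mul_mem_degIn ih hx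

theorem koszulBracket_const_mem_degIn [GradedAlgebra 𝒜] {k d : ℤ}
    {Δ : LaurentSeries A →ₗ[K] LaurentSeries A}
    (hΔ : ∀ x, x ∈ degIn 𝒜 k 0 → Δ x ∈ degIn 𝒜 k d) {a : LaurentSeries A}
    (ha : a ∈ degIn 𝒜 k 0) (n : ℕ) :
    koszulBracket (fun x => Δ x) (fun _ : Fin n => 0) (fun _ => a) ∈ degIn 𝒜 k d := by
  rw [koszulBracket_const]
  refine Submodule.sum_mem _ fun i _ => Submodule.smul_of_tower_mem _ _ ?_
  have h := mul_mem_degIn (hΔ _ (pow_mem_degIn ha i)) (pow_mem_degIn ha (n - i))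
  rw [add_zero] at h
  rcases Nat.even_or_odd (n - i) with he | he
  · rwa [he.neg_one_pow, one_mul]
  · rw [he.neg_one_pow, neg_one_mul]
    exact neg_mem h

theorem IsCompleteFiltration.eq_zero_of_mem [GradedAlgebra 𝒜] {F : ℕ → Submodule K A}
    (hF : IsCompleteFiltration 𝒜 F) {k d : ℤ} {x : LaurentSeries A} (hx : x ∈ degIn 𝒜 k d)
    (h : ∀ p, x ∈ coeffIn fun _ => F p) : x = 0 := by
  ext m
  exact hF.separated _ _ (hx m) fun p => h p m

/-- Limits are taken coefficient by coefficient, where completeness is available in a fixed degree.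
The uniform pole bound s makes the resulting family a Laurent series. -/
theorem IsCompleteFiltration.exists_limit [GradedAlgebra 𝒜] {F : ℕ → Submodule K A}
    (hF : IsCompleteFiltration 𝒜 F) {k d s : ℤ} {u : ℕ → LaurentSeries A}
    (hu : ∀ p, u p ∈ degIn 𝒜 k d) (hs : ∀ p, u p ∈ orderGE K A s)
    (h : ∀ p, u (p + 1) - u p ∈ coeffIn fun _ => F p) :
    ∃ x ∈ degIn 𝒜 k d, x ∈ orderGE K A s ∧ ∀ p, x - u p ∈ coeffIn fun _ => F p := by
  choose c hc hcu using fun m : ℤ => hF.complete (m * (k - 1) + d) (fun p => (u p).coeff m)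
    (fun p => hu p m) (fun p => h p m)
  have hc0 : ∀ m, m < s → c m = 0 := by
    intro m hm
    refine hF.separated _ _ (hc m) fun p => ?_
    have h1 := hcu m p
    rwa [mem_orderGE.1 (hs p) m hm, sub_zero] at h1
  have hb : BddBelow (Function.support c) := by
    refine ⟨s, fun m hm => ?_⟩
    by_contra hlt
    exact hm (hc0 m (by omega))
  exact ⟨HahnSeries.ofSuppBddBelow c hb, hc, mem_orderGE.2 hc0, fun p m => hcu m p⟩

/-- The n-th bracket at an element of F¹ lies in Fⁿ, so convergence to zero is equivalent to a bound
on each truncation. -/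
theorem mem_MC_iff {k : ℤ} {F : ℕ → Submodule K A} (hF : IsRingFiltration F)
    {Δ : ℕ → Module.End K A}
    (hΔ : ∀ p x, (x ∈ coeffIn fun _ => F p) → laurentLin Δ x ∈ coeffIn fun _ => F p)
    {a : LaurentSeries A} :
    a ∈ MC 𝒜 k F Δ ↔ a ∈ orderGE K A (-1) ∧ a ∈ degIn 𝒜 k 0 ∧ (a ∈ coeffIn fun _ => F 1) ∧
      ∀ N, mcSum (laurentLin Δ) N a ∈ coeffIn fun _ => F (N + 1) := by
  have hJ := isRingFiltration_coeffIn hF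
  rw [mem_orderGE, mem_degIn_zero, mem_coeffIn]
  refine and_congr_right fun _ => and_congr_right fun _ => and_congr_right fun ha => ?_
  constructor
  · intro h N
    obtain ⟨N₀, hN⟩ := h (N + 1)
    have h1 : mcSum (laurentLin Δ) (max N N₀) a ∈ coeffIn fun _ => F (N + 1) := by
      rw [← neg_mem_iff, ← zero_sub]
      exact hN _ (le_max_right _ _)
    have h2 := Submodule.sub_mem _ h1
      (mcSum_sub_mcSum_mem hJ hΔ (a := a) ha (le_max_left N N₀))
    rwa [sub_sub_cancel] at h2
  · intro h p
    refine ⟨p, fun N hN m => ?_⟩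
    rw [zero_sub, HahnSeries.coeff_neg, neg_mem_iff]
    exact hF.anti (by omega) (h N m)

/-- Separatedness holds only degree by degree, hence the degree assumptions on both limits. -/
theorem IsPushforward.unique {B : Type*} [Ring B] [Algebra K B] [GradedAlgebra 𝒜]
    {F : ℕ → Submodule K A} (hF : IsCompleteFiltration 𝒜 F) {f : ℕ → (B →ₗ[K] A)}
    {b : LaurentSeries B} {a a' : LaurentSeries A} {k : ℤ} (ha : a ∈ degIn 𝒜 k 0)
    (ha' : a' ∈ degIn 𝒜 k 0) (h : IsPushforward F f b a) (h' : IsPushforward F f b a') :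
    a = a' := by
  rw [← sub_eq_zero]
  refine hF.eq_zero_of_mem (Submodule.sub_mem _ ha ha') fun p m => ?_
  obtain ⟨N, hN⟩ := h p
  obtain ⟨N', hN'⟩ := h' p
  have h1 := (F p).sub_mem (hN _ (le_max_left N N') m) (hN' _ (le_max_right N N') m)
  rwa [← HahnSeries.coeff_sub, sub_sub_sub_cancel_right] at h1

theorem mcSum_mem_orderGE {k : ℤ} {Δ : (Module.End K A)⟦X⟧} (hk : Odd k) (hΔ : IsDerivedBV 𝒜 k Δ) {a : LaurentSeries A}
    (ha : a ∈ orderGE K A (-1)) (hdeg : a ∈ degIn 𝒜 k 0) (N : ℕ) :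
    mcSum (laurentHom K A Δ) N a ∈ orderGE K A (-1) :=
  Submodule.sum_mem _ fun _ hn => Submodule.smul_mem _ _
    (koszulBracket_const_mem_orderGE hk hΔ ha (mem_degIn_zero.1 hdeg) (Finset.mem_Icc.1 hn).1)

theorem perturbedh_mem_degIn {k : ℤ} {Δ : (Module.End K A)⟦X⟧} {h : Module.End K A}
    (hΔ : IsDerivedBV 𝒜 k Δ) (hh : HasDegree 𝒜 𝒜 (-1) h) {d : ℤ}
    {x : LaurentSeries A} (hx : x ∈ degIn 𝒜 k d) :
    laurentHom K A (geomSeries (PowerSeries.C h * plusPart Δ)) (coeffLin h x) ∈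
      degIn 𝒜 k (d - 1) := by
  have h1 : SeriesMaps (plusPart Δ) (fun m => 𝒜 (m * (k - 1) + (d - 1)))
      (fun m => 𝒜 (m * (k - 1) + (d - 1 + 1))) := (HasDegree.seriesMaps hΔ.degree _).plusPart
  have h2 : SeriesMaps (PowerSeries.C h) (fun m => 𝒜 (m * (k - 1) + (d - 1 + 1)))
      (fun m => 𝒜 (m * (k - 1) + (d - 1))) := SeriesMaps.C fun m x hx => by
    have := hh _ x hx
    rwa [show m * (k - 1) + (d - 1 + 1) + -1 = m * (k - 1) + (d - 1) by ring] at this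
  exact (h2.mul h1).geomSeries.laurentHom_mem (hh.coeffLin_mem hx)

end MaurerCartan

/-! ### Lifting Maurer–Cartan elements along the contraction -/

section Transfer

variable {K A B : Type*} [Field K] [Ring A] [Algebra K A] [Ring B] [Algebra K B]
  {𝒜 : ℤ → Submodule K A} {ℬ : ℤ → Submodule K B} [GradedAlgebra 𝒜] [GradedAlgebra ℬ]
  {k : ℤ} {F : ℕ → Submodule K A} {Δ : (Module.End K A)⟦X⟧} {dB : Module.End K B}
  {σ : A →ₗ[K] B} {τ : B →ₗ[K] A} {h : Module.End K A}

/-- Every degree zero element `b` of `t⁻¹F¹B[[t]]` lifts to a solution `a` of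
`h (∑ K(Δ)ₙ(a, …, a)/n!) = 0` in the kernel of `h` with `σ a = b`. -/
theorem exists_lift (hA : GradedCommutative 𝒜) (hk : Odd k) (hΔ : IsCompleteDerivedBV 𝒜 k F Δ)
    (hc : IsSemifullDGContraction 𝒜 ℬ (PowerSeries.coeff 0 Δ) dB σ τ h)
    (hh : RespectsFiltration F F h) (hτσ : RespectsFiltration F F (τ ∘ₗ σ))
    {b : LaurentSeries B} (hb : b ∈ orderGE K B (-1)) (hbd : b ∈ degIn ℬ k 0)
    (hbF : b ∈ coeffIn fun _ => inducedFiltration F τ 1) :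
    ∃ a ∈ orderGE K A (-1), a ∈ degIn 𝒜 k 0 ∧ (a ∈ coeffIn fun _ => F 1) ∧
      coeffLin h a = 0 ∧ coeffLin σ a = b ∧
      ∀ N, coeffLin h (mcSum (laurentHom K A Δ) N a) ∈ coeffIn fun _ => F (N + 1) := by
  have c := isPerturbedContraction hA hΔ hc hh hτσ
  have hcon := hc.contraction
  have hΔdeg : ∀ x, x ∈ degIn 𝒜 k 0 → laurentHom K A Δ x ∈ degIn 𝒜 k 1 := fun x hx =>
    (HasDegree.seriesMaps hΔ.bv.degree 0).laurentHom_mem hx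
  have hmem := c.DP_mem
  have hone := c.DP_one
  rw [← laurentHom_eq_add] at hmem hone
  -- Invariants of the Newton iteration: everything required of the lift, with the equation solved
  -- modulo F^{q+1}. The start is τb, for which the empty sum makes the equation trivial.
  let Good : ℕ → LaurentSeries A → Prop := fun q a =>
    a ∈ orderGE K A (-1) ∧ a ∈ degIn 𝒜 k 0 ∧ (a ∈ coeffIn fun _ => F 1) ∧
      coeffLin h a = 0 ∧ coeffLin σ a = b ∧
      coeffLin h (mcSum (laurentHom K A Δ) q a) ∈ coeffIn fun _ => F (q + 1)
  have h0 : Good 0 (coeffLin τ b) := by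
    refine ⟨coeffLin_mem_orderGE τ hb, by simpa using hcon.degree_τ.coeffLin_mem hbd,
      c.T_mem 1 b hbF, c.H_T b, c.S_T b, ?_⟩
    simp [mcSum]
  have step : ∀ q (a : {a // Good q a}), ∃ a' : {a // Good (q + 1) a},
      (a' : LaurentSeries A) - a ∈ coeffIn fun _ => F (q + 1) := by
    rintro q ⟨a, ha, had, haF, hha, hσa, hq⟩
    have hN := c.newton_step haF (p := q) (by rwa [← laurentHom_eq_add])
    rw [← laurentHom_eq_add] at hN
    set x := laurentHom K A (geomSeries (PowerSeries.C h * plusPart Δ))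
      (coeffLin h (mcSum (laurentHom K A Δ) (q + 1) a)) with hx
    refine ⟨⟨a + x, ?_, ?_, ?_, ?_, ?_, hN.2⟩, by simpa using hN.1⟩
    · exact Submodule.add_mem _ ha (laurentLin_mem_orderGE _
        (coeffLin_mem_orderGE _ (mcSum_mem_orderGE hk hΔ.bv ha had _)))
    · refine Submodule.add_mem _ had ?_
      have h1 : mcSum (laurentHom K A Δ) (q + 1) a ∈ degIn 𝒜 k 1 :=
        Submodule.sum_mem _ fun n _ => Submodule.smul_mem _ _
          (koszulBracket_const_mem_degIn hΔdeg had n)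
      simpa using perturbedh_mem_degIn hΔ.bv hcon.degree_h h1
    · exact Submodule.add_mem _ haF (c.filtV.anti (by omega) hN.1)
    · rw [map_add, hha, zero_add]; exact c.H_G_H _
    · rw [map_add, hσa, hx, c.S_G_H, add_zero]
  choose f hf using step
  let s : ∀ q, {a // Good q a} := fun q => Nat.rec ⟨_, h0⟩ (fun q a => f q a) q
  have hs : ∀ q, (s (q + 1)).1 - (s q).1 ∈ coeffIn fun _ => F q := by
    intro q m
    have h1 : (s (q + 1)).1 - (s q).1 ∈ coeffIn fun _ => F (q + 1) := hf q (s q)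
    exact hΔ.filtration.anti (Nat.le_succ q) (h1 m)
  obtain ⟨a, had, ha, has⟩ := hΔ.filtration.exists_limit (u := fun q => (s q).1)
    (fun q => (s q).2.2.1) (fun q => (s q).2.1)
    hs
  have haF : a ∈ coeffIn fun _ => F 1 := by
    have := Submodule.add_mem _ (has 1) (s 1).2.2.2.1
    rwa [sub_add_cancel] at this
  refine ⟨a, ha, had, haF, ?_, ?_, fun N => ?_⟩
  · refine hΔ.filtration.eq_zero_of_mem (hcon.degree_h.coeffLin_mem had) fun p => ?_
    have := c.H_mem p _ (has p)
    rwa [map_sub, (s p).2.2.2.2.1, sub_zero] at this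
  · have h1 : coeffLin τ (coeffLin σ a - b) = 0 := by
      refine hΔ.filtration.eq_zero_of_mem (k := k) (d := 0) ?_ fun p => ?_
      · have := hcon.degree_τ.coeffLin_mem (Submodule.sub_mem _
          (by simpa using hcon.degree_σ.coeffLin_mem had) hbd)
        simpa using this
      · have := c.T_mem p _ (c.S_mem p _ (has p))
        rwa [map_sub (coeffLin σ), (s p).2.2.2.2.2.1] at this
    have h2 := c.S_T (coeffLin σ a - b)
    rw [h1, map_zero] at h2
    exact (sub_eq_zero.1 h2.symm)
  · have h1 := mcSum_add_sub_mem c.filtV hmem hone (s (N + 1)).2.2.2.1 (Nat.le_add_left 1 N)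
      (has (N + 1)) (N := N + 1) (Nat.le_add_left 1 N)
    rw [add_sub_cancel] at h1
    have h2 := Submodule.add_mem _ (c.filtV.anti (Nat.le_succ _) h1) (hmem _ _ (has (N + 1)))
    rw [sub_add_cancel] at h2
    have h3 := c.H_mem _ _ (Submodule.sub_mem _ h2
      (mcSum_sub_mcSum_mem c.filtV hmem haF (Nat.le_succ N)))
    have h4 := Submodule.add_mem _ h3
      (c.filtV.anti (Nat.le_succ _) (s (N + 1)).2.2.2.2.2.2)
    rw [← map_add] at h4
    convert h4 using 2
    abel

/-- Here τ̆(e^{σa}) ≡ e^a modulo F^{N+1} for all N, and taking logarithms turns this into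
convergence of the cumulant series to a. -/
theorem isPushforward_of_ker [CharZero K] (hA : GradedCommutative 𝒜) (hΔ : IsCompleteDerivedBV 𝒜 k F Δ)
    (hc : IsSemifullDGContraction 𝒜 ℬ (PowerSeries.coeff 0 Δ) dB σ τ h)
    (hh : RespectsFiltration F F h) (hτσ : RespectsFiltration F F (τ ∘ₗ σ))
    {a : LaurentSeries A} (haF : a ∈ coeffIn fun _ => F 1) (ha : coeffLin h a = 0)
    (hN : ∀ N, coeffLin h (mcSum (laurentHom K A Δ) N a) ∈ coeffIn fun _ => F (N + 1)) :
    IsPushforward F (perturbedτ Δ τ h) (coeffLin σ a) a := by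
  have c := isPerturbedContraction hA hΔ hc hh hτσ
  intro p
  refine ⟨p + 1, fun N hpN m => ?_⟩
  have h1 := c.expSum_sub_mem ha haF (N := N) (by rw [← laurentHom_eq_add]; exact hN N)
  have h2 := cumulantSum_sub_mem c.filtW c.filtV
    (f := laurentHom K A (geomSeries (PowerSeries.C h * plusPart Δ)) ∘ₗ coeffLin τ)
    (fun p x hx => c.G_mem p _ (c.T_mem p x hx))
    (by rw [LinearMap.comp_apply, c.T_one, c.G_one]) (c.S_mem 1 a haF) haF (by omega) h1
  rw [← laurentLin_perturbedτ] at h2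
  have h3 := neg_mem h2
  rw [neg_sub] at h3
  exact hΔ.filtration.anti (by omega : p ≤ N + 1) (h3 m)

end Transfer

end DerivedBV

end

theorem mainTheorem6 {K A B : Type*} [Field K] [CharZero K]
    [Ring A] [Algebra K A] (𝒜 : ℤ → Submodule K A) [GradedAlgebra 𝒜]
    [Ring B] [Algebra K B] (ℬ : ℤ → Submodule K B) [GradedAlgebra ℬ]
    (hA : DerivedBV.GradedCommutative 𝒜) (hB : DerivedBV.GradedCommutative ℬ)
    (k : ℤ) (hk : Odd k)
    (F : ℕ → Submodule K A) (Δ : PowerSeries (Module.End K A))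
    (hΔ : DerivedBV.IsCompleteDerivedBV 𝒜 k F Δ)
    (dB : Module.End K B) (σ : A →ₗ[K] B) (τ : B →ₗ[K] A) (h : Module.End K A)
    (hc : DerivedBV.IsSemifullDGContraction 𝒜 ℬ (PowerSeries.coeff 0 Δ) dB σ τ h)
    (hh : DerivedBV.RespectsFiltration F F h)
    (hτσ : DerivedBV.RespectsFiltration F F (τ ∘ₗ σ)) :
    ∃ e : DerivedBV.MC ℬ k (DerivedBV.inducedFiltration F τ)
          (DerivedBV.transferredΔ Δ dB σ τ h) ≃
        {a : LaurentSeries A // a ∈ DerivedBV.MC 𝒜 k F (fun n => PowerSeries.coeff n Δ) ∧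
          DerivedBV.laurentExt (DerivedBV.perturbedh Δ h) a = 0},
      (∀ b : DerivedBV.MC ℬ k (DerivedBV.inducedFiltration F τ)
          (DerivedBV.transferredΔ Δ dB σ τ h),
        DerivedBV.IsPushforward F (DerivedBV.perturbedτ Δ τ h)
        (b : LaurentSeries B) (e b : LaurentSeries A)) ∧
      (∀ a, (e.symm a : LaurentSeries B) =
        DerivedBV.laurentExt (DerivedBV.perturbedσ Δ σ h) (a : LaurentSeries A)) := by
  open DerivedBV in
  have c := isPerturbedContraction hA hΔ hc hh hτσ
  have hF := hΔ.filtration.isRingFiltration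
  have hFB := isRingFiltration_induced hF hτσ hc.σ_ττ
  have hcon := hc.contraction
  have hΔA : laurentLin (fun n => PowerSeries.coeff n Δ) = coeffLin (PowerSeries.coeff 0 Δ) +
      laurentHom K A (plusPart Δ) := by rw [← laurentHom_eq_add, laurentHom_apply]
  have hΔB := laurentLin_transferredΔ Δ dB σ τ h
  have memA : ∀ a, a ∈ MC 𝒜 k F (fun n => PowerSeries.coeff n Δ) ↔ _ := fun a =>
    mem_MC_iff hF (by rw [hΔA]; exact c.DP_mem)
  have memB : ∀ b, b ∈ MC ℬ k (inducedFiltration F τ) (transferredΔ Δ dB σ τ h) ↔ _ := fun b =>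
    mem_MC_iff hFB (by rw [hΔB]; exact c.transferred_mem)
  simp only [hΔA] at memA
  simp only [hΔB] at memB
  have hker : ∀ a, laurentExt (perturbedh Δ h) a = 0 ↔ coeffLin h a = 0 := by
    intro a
    rw [← laurentLin_apply, laurentLin_perturbedh]
    exact c.G_H_eq_zero_iff
  have hσ : ∀ a, coeffLin h a = 0 → laurentExt (perturbedσ Δ σ h) a = coeffLin σ a := by
    intro a ha
    rw [← laurentLin_apply, laurentLin_perturbedσ, LinearMap.comp_apply, c.G'_of_ker ha]
  have hMC : ∀ a : {a : LaurentSeries A // a ∈ MC 𝒜 k F (fun n => PowerSeries.coeff n Δ) ∧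
      laurentExt (perturbedh Δ h) a = 0}, laurentExt (perturbedσ Δ σ h) a ∈
        MC ℬ k (inducedFiltration F τ) (transferredΔ Δ dB σ τ h) := by
    rintro ⟨a, ha, hka⟩
    rw [hker] at hka
    obtain ⟨h1, h2, h3, h4⟩ := (memA a).1 ha
    rw [hσ a hka, memB]
    exact ⟨coeffLin_mem_orderGE σ h1, by simpa using hcon.degree_σ.coeffLin_mem h2,
      c.S_mem 1 a h3, fun N => c.mc_S hka h3 (h4 N)⟩
  have hpush : ∀ a : {a : LaurentSeries A // a ∈ MC 𝒜 k F (fun n => PowerSeries.coeff n Δ) ∧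
      laurentExt (perturbedh Δ h) a = 0},
      IsPushforward F (perturbedτ Δ τ h) (laurentExt (perturbedσ Δ σ h) a) a := by
    rintro ⟨a, ha, hka⟩
    rw [hker] at hka
    obtain ⟨-, -, h3, h4⟩ := (memA a).1 ha
    rw [hσ a hka]
    refine isPushforward_of_ker hA hΔ hc hh hτσ h3 hka fun N => c.H_mem _ _ ?_
    rw [laurentHom_eq_add]
    exact h4 N
  -- Injectivity holds because a is recovered from σ̆(a) as its push-forward, and surjectivity is
  -- the Newton lift.
  have hbij : Function.Bijective fun a => (⟨laurentExt (perturbedσ Δ σ h) a.1, hMC a⟩ :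
      MC ℬ k (inducedFiltration F τ) (transferredΔ Δ dB σ τ h)) := by
    constructor
    · intro a a' haa'
      have e : laurentExt (perturbedσ Δ σ h) a.1 = laurentExt (perturbedσ Δ σ h) a'.1 :=
        congrArg Subtype.val haa'
      have h1 := hpush a'
      rw [← e] at h1
      exact Subtype.ext (IsPushforward.unique hΔ.filtration ((memA a.1).1 a.2.1).2.1
        ((memA a'.1).1 a'.2.1).2.1 (hpush a) h1)
    · rintro ⟨b, hb⟩
      obtain ⟨h1, h2, h3, h4⟩ := (memB b).1 hb
      obtain ⟨a, a1, a2, a3, a4, a5, a6⟩ := exists_lift hA hk hΔ hc hh hτσ h1 h2 h3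
      rw [laurentHom_eq_add] at a6
      refine ⟨⟨a, (memA a).2 ⟨a1, a2, a3, fun N => ?_⟩, (hker a).2 a4⟩, Subtype.ext ?_⟩
      · refine c.mc_of_mc_S a4 a3 (a6 N) ?_
        rw [a5]
        exact h4 N
      · exact (hσ a a4).trans a5
  -- The equivalence is built from σ̆, so its inverse is σ̆ by definition. The push-forward
  -- description then follows by rewriting b as σ̆ of its preimage.
  refine ⟨(Equiv.ofBijective _ hbij).symm, fun b => ?_, fun a => rfl⟩
  have h1 := hpush ((Equiv.ofBijective _ hbij).symm b)
  have h2 := congrArg Subtype.val ((Equiv.ofBijective _ hbij).apply_symm_apply b)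
  change laurentExt (perturbedσ Δ σ h) ((Equiv.ofBijective _ hbij).symm b).1 = b at h2
  rwa [h2] at h1
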